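/- Let $N\ge 1$ be an integer, $s\in(0,1)$ and $0<t<2s<N$, and put $2^*_s(t)=\frac{2(N-t)}{N-2s}$. Let $\dot H^s(\mathbb R^N)$ be the real Hilbert space obtained as the completion of $C_c^\infty(\mathbb R^N)$ under the norm given by the inner product $$\langle u,v\rangle_{\dot H^s}=\frac{C_{N,s}}{2}\iint_{\mathbb R^{2N}}\frac{(u(x)-u(y))(v(x)-v(y))}{|x-y|^{N+2s}}\,dx\,dy,\qquad C_{N,s}=\Big(\int_{\mathbb R^N}\frac{1-\cos\xi_1}{|\xi|^{N+2s}}\,d\xi\Big)^{-1}.$$ Let $w:\mathbb R^N\to\mathbb R$ be a measurable weight with $w>0$ almost everywhere and $|x|^{2t/2^*_s(t)}\,w\in L^{\frac{N-t}{2s-t}}(\mathbb R^N)$, and let $L^2_w=L^2(\mathbb R^N,w\,dx)$ be the real weighted space with $\langle f,g\rangle_{L^2_w}=\int_{\mathbb R^N} fg\,w\,dx$. Then the following hold. 1. The inclusion of $C_c^\infty(\mathbb R^N)$ in $L^2_w$ extends to exactly one bounded linear operator $i:\dot H^s(\mathbb R^N)\to L^2_w$; the operator $i$ is injective (so it is an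 embedding) and compact. 2. For $v\in\dot H^s(\mathbb R^N)$ and $f\in L^2_w$ write $\frac{(-\Delta)^s}{w}v=f$ if $(-\Delta)^s v=fw$ weakly in $\mathbb R^N$, i.e. $\langle v,\varphi\rangle_{\dot H^s}=\int_{\mathbb R^N} f\varphi\,w\,dx$ for all $\varphi\in C_c^\infty(\mathbb R^N)$. The inverse $T=\big(\frac{(-\Delta)^s}{w}\big)^{-1}:L^2_w\to\dot H^s(\mathbb R^N)$ is well defined and continuous: there is an injective bounded linear operator $T:L^2_w\to\dot H^s(\mathbb R^N)$ such that, for all $f\in L^2_w$ and $v\in\dot H^s(\mathbb R^N)$, $\frac{(-\Delta)^s}{w}v=f$ if and only if $v=Tf$. 3. The operator $i\circ T:L^2_w\to L^2_w$ is compact and self-adjoint, and its spectrum is discrete: for every $\varepsilon>0$ only finitely many points $\mu$ of the spectrum satisfy $|\mu|\ge\varepsilon$, and every nonzero point of the spectrum is an eigenvalue of finite multiplicity. -/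

import Mathlib

open MeasureTheory Set
open scoped RealInnerProductSpace ContDiff

noncomputable section

/-- Euclidean space `ℝ^N`. -/
abbrev RN (N : ℕ) : Type := EuclideanSpace ℝ (Fin N)

/-- The real vector space `C_c^∞(ℝ^N)`, as a space of functions. -/
def smoothCompactSupport (N : ℕ) : Submodule ℝ (RN N → ℝ) where
  carrier := {φ | ContDiff ℝ ∞ φ ∧ HasCompactSupport φ}
  add_mem' := fun ha hb => ⟨ha.1.add hb.1, ha.2.add hb.2⟩
  zero_mem' := ⟨contDiff_const, HasCompactSupport.zero⟩
  smul_mem' := fun c _ ha => ⟨contDiff_const.smul ha.1, ha.2.smul_left (f := fun _ => c)⟩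

/-- `C_c^∞(ℝ^N)` as a type of its own, which is to carry the Gagliardo semi-norm of order `s`
(and not the topology of pointwise convergence). -/
def TestFun (N : ℕ) (_s : Ioo (0 : ℝ) 1) : Type := ↥(smoothCompactSupport N)

instance (N : ℕ) (s : Ioo (0 : ℝ) 1) : AddCommGroup (TestFun N s) :=
  inferInstanceAs (AddCommGroup ↥(smoothCompactSupport N))

instance (N : ℕ) (s : Ioo (0 : ℝ) 1) : Module ℝ (TestFun N s) :=
  inferInstanceAs (Module ℝ ↥(smoothCompactSupport N))

instance (N : ℕ) (s : Ioo (0 : ℝ) 1) : CoeFun (TestFun N s) (fun _ => RN N → ℝ) :=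
  ⟨fun φ => φ.1⟩

/-- The constant `C_{N,s} = (∫ (1 - cos ξ₁) / |ξ|^(N+2s) dξ)⁻¹` of the fractional Laplacian. -/
def fracConst (N : ℕ) [NeZero N] (s : ℝ) : ℝ :=
  (∫ ξ : RN N, (1 - Real.cos (ξ 0)) / ‖ξ‖ ^ ((N : ℝ) + 2 * s))⁻¹

/-- The Gagliardo form
`(C_{N,s} / 2) ∬ (u(x) - u(y)) (v(x) - v(y)) / |x - y|^(N+2s) dx dy`. -/
def gagliardo (N : ℕ) [NeZero N] (s : ℝ) (u v : RN N → ℝ) : ℝ :=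
  fracConst N s / 2 * ∫ p : RN N × RN N,
    (u p.1 - u p.2) * (v p.1 - v p.2) / ‖p.1 - p.2‖ ^ ((N : ℝ) + 2 * s)

theorem fracConst_nonneg (N : ℕ) [NeZero N] (s : ℝ) : 0 ≤ fracConst N s := by
  unfold fracConst
  refine inv_nonneg.2 (integral_nonneg fun ξ => ?_)
  have := Real.cos_le_one (ξ 0)
  exact div_nonneg (by simpa using this) (by positivity)

/-- The kernel `min(|h|², 1) / |h|^(N+2s)` is integrable for `0 < s < 1`. -/
theorem integrable_gagliardoKernel (N : ℕ) [NeZero N] {s : ℝ} (hs : s ∈ Ioo (0 : ℝ) 1) :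
    Integrable (fun h : RN N => min (‖h‖ ^ 2) 1 / ‖h‖ ^ ((N : ℝ) + 2 * s)) := by
  have hN : 1 ≤ N := Nat.one_le_iff_ne_zero.2 (NeZero.ne N)
  rw [integrable_fun_norm_addHaar (μ := (volume : Measure (RN N)))
    (f := fun r : ℝ => min (r ^ 2) 1 / r ^ ((N : ℝ) + 2 * s))]
  rw [← Ioo_union_Ici_eq_Ioi (zero_lt_one' ℝ), integrableOn_union,
    integrableOn_Ici_iff_integrableOn_Ioi]
  have hdim : Module.finrank ℝ (RN N) = N := by simp
  rw [hdim]
  have hpow : ∀ r : ℝ, 0 < r → r ^ (N - 1) = r ^ ((N : ℝ) - 1) := by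
    intro r _
    rw [← Real.rpow_natCast, Nat.cast_sub hN, Nat.cast_one]
  constructor
  · have h1 : IntegrableOn (fun r : ℝ => r ^ (1 - 2 * s)) (Ioo 0 1) :=
      (intervalIntegral.integrableOn_Ioo_rpow_iff zero_lt_one).2 (by linarith [hs.2])
    refine h1.congr_fun (fun r hr => ?_) measurableSet_Ioo
    have h2 : min (r ^ 2) 1 = r ^ (2 : ℝ) := by
      rw [min_eq_left (by nlinarith [hr.1, hr.2])]
      norm_num
    simp only [smul_eq_mul]
    rw [hpow r hr.1, h2, ← Real.rpow_sub hr.1, ← Real.rpow_add hr.1]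
    congr 1
    ring
  · have h1 : IntegrableOn (fun r : ℝ => r ^ (-1 - 2 * s)) (Ioi 1) :=
      integrableOn_Ioi_rpow_of_lt (by linarith [hs.1]) zero_lt_one
    refine h1.congr_fun (fun r hr => ?_) measurableSet_Ioi
    have hr1 : (1 : ℝ) < r := hr
    have hr0 : (0 : ℝ) < r := by linarith
    have h2 : min (r ^ 2) 1 = r ^ (0 : ℝ) := by
      rw [min_eq_right (by nlinarith)]
      simp
    simp only [smul_eq_mul]
    rw [hpow r hr0, h2, ← Real.rpow_sub hr0, ← Real.rpow_add hr0]
    congr 1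
    ring

/-- The Gagliardo integral of a test function is finite. -/
theorem integrable_gagliardo_sq (N : ℕ) [NeZero N] (s : Ioo (0 : ℝ) 1) (φ : TestFun N s) :
    Integrable (fun p : RN N × RN N =>
      (φ p.1 - φ p.2) ^ 2 / ‖p.1 - p.2‖ ^ ((N : ℝ) + 2 * (s : ℝ))) := by
  have hsm : ContDiff ℝ ∞ φ.1 := φ.2.1
  have hcs : HasCompactSupport φ.1 := φ.2.2
  obtain ⟨L, hL⟩ := hsm.lipschitzWith_of_hasCompactSupport hcs (by simp)
  obtain ⟨M, hM⟩ := hcs.exists_bound_of_continuous hsm.continuous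
  set C : ℝ := (L : ℝ) ^ 2 + 4 * M ^ 2 with hC
  set k : RN N → ℝ := fun h => min (‖h‖ ^ 2) 1 / ‖h‖ ^ ((N : ℝ) + 2 * (s : ℝ)) with hk
  set K : Set (RN N) := tsupport φ.1 with hK
  have hKm : MeasurableSet K := (isClosed_tsupport _).measurableSet
  have hi : Integrable (K.indicator (fun _ => (1 : ℝ))) (volume : Measure (RN N)) :=
    (integrable_indicator_iff hKm).2
      (integrableOn_const (hs := hcs.isCompact.measure_lt_top.ne))
  have h2 : Integrable (fun p : RN N × RN N =>
      K.indicator (fun _ => (1 : ℝ)) p.2 * k (p.1 - p.2)) :=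
    hi.convolution_integrand (ContinuousLinearMap.mul ℝ ℝ)
      (integrable_gagliardoKernel N s.2)
  have h1 : Integrable (fun p : RN N × RN N =>
      K.indicator (fun _ => (1 : ℝ)) p.1 * k (p.1 - p.2)) := by
    refine h2.swap.congr (Filter.Eventually.of_forall fun p => ?_)
    simp only [Function.comp, Prod.fst_swap, Prod.snd_swap, hk, norm_sub_rev p.2 p.1]
  refine ((h1.add h2).const_mul C).mono' ?_ (Filter.Eventually.of_forall fun p => ?_)
  · have hm : Measurable φ.1 := hsm.continuous.measurable
    exact (by fun_prop : Measurable (fun p : RN N × RN N =>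
      (φ.1 p.1 - φ.1 p.2) ^ 2 / ‖p.1 - p.2‖ ^ ((N : ℝ) + 2 * (s : ℝ)))).aestronglyMeasurable
  · have hden : 0 ≤ ‖p.1 - p.2‖ ^ ((N : ℝ) + 2 * (s : ℝ)) := by positivity
    rw [Real.norm_of_nonneg (div_nonneg (sq_nonneg _) hden)]
    have hk0 : 0 ≤ k (p.1 - p.2) := div_nonneg (by positivity) hden
    have hind : ∀ x, 0 ≤ K.indicator (fun _ => (1 : ℝ)) x := fun x =>
      indicator_nonneg (fun _ _ => zero_le_one) x
    by_cases hp : p.1 ∈ K ∨ p.2 ∈ K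
    · have hge : 1 ≤ K.indicator (fun _ => (1 : ℝ)) p.1 + K.indicator (fun _ => (1 : ℝ)) p.2 := by
        rcases hp with hp | hp
        · have := hind p.2
          simp only [indicator_of_mem hp] at *
          linarith
        · have := hind p.1
          simp only [indicator_of_mem hp] at *
          linarith
      have hnum : (φ.1 p.1 - φ.1 p.2) ^ 2 ≤ C * min (‖p.1 - p.2‖ ^ 2) 1 := by
        have hl : |φ.1 p.1 - φ.1 p.2| ≤ L * ‖p.1 - p.2‖ := by
          simpa [dist_eq_norm] using hL.dist_le_mul p.1 p.2
        have hb1 := hM p.1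
        have hb2 := hM p.2
        rw [Real.norm_eq_abs, abs_le] at hb1 hb2
        rw [← sq_abs]
        have h0 := abs_nonneg (φ.1 p.1 - φ.1 p.2)
        have hb : |φ.1 p.1 - φ.1 p.2| ≤ 2 * M := abs_le.2 ⟨by linarith, by linarith⟩
        rcases min_cases (‖p.1 - p.2‖ ^ 2) 1 with ⟨he, _⟩ | ⟨he, _⟩
        · rw [he]
          have := pow_le_pow_left₀ h0 hl 2
          nlinarith [sq_nonneg M, sq_nonneg ‖p.1 - p.2‖,
            mul_nonneg (sq_nonneg M) (sq_nonneg ‖p.1 - p.2‖)]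
        · rw [he]
          have := pow_le_pow_left₀ h0 hb 2
          nlinarith [sq_nonneg (L : ℝ)]
      have hC0 : 0 ≤ C := by positivity
      calc (φ.1 p.1 - φ.1 p.2) ^ 2 / ‖p.1 - p.2‖ ^ ((N : ℝ) + 2 * (s : ℝ))
          ≤ C * min (‖p.1 - p.2‖ ^ 2) 1 / ‖p.1 - p.2‖ ^ ((N : ℝ) + 2 * (s : ℝ)) :=
            div_le_div_of_nonneg_right hnum hden
        _ = C * (1 * k (p.1 - p.2)) := by simp only [hk]; ring
        _ ≤ C * ((K.indicator (fun _ => (1 : ℝ)) p.1 + K.indicator (fun _ => (1 : ℝ)) p.2) *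
              k (p.1 - p.2)) :=
            mul_le_mul_of_nonneg_left (mul_le_mul_of_nonneg_right hge hk0) hC0
        _ = _ := by simp only [Pi.add_apply]; ring
    · push Not at hp
      have e1 : φ.1 p.1 = 0 := image_eq_zero_of_notMem_tsupport hp.1
      have e2 : φ.1 p.2 = 0 := image_eq_zero_of_notMem_tsupport hp.2
      simp [e1, e2, indicator_of_notMem hp.1, indicator_of_notMem hp.2]

theorem integrable_gagliardo (N : ℕ) [NeZero N] (s : Ioo (0 : ℝ) 1) (φ ψ : TestFun N s) :
    Integrable (fun p : RN N × RN N =>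
      (φ p.1 - φ p.2) * (ψ p.1 - ψ p.2) / ‖p.1 - p.2‖ ^ ((N : ℝ) + 2 * (s : ℝ))) := by
  refine ((integrable_gagliardo_sq N s φ).add (integrable_gagliardo_sq N s ψ)).mono' ?_
    (Filter.Eventually.of_forall fun p => ?_)
  · have hm : Measurable φ.1 := (show ContDiff ℝ ∞ φ.1 from φ.2.1).continuous.measurable
    have hm' : Measurable ψ.1 := (show ContDiff ℝ ∞ ψ.1 from ψ.2.1).continuous.measurable
    exact (by fun_prop : Measurable (fun p : RN N × RN N =>
      (φ.1 p.1 - φ.1 p.2) * (ψ.1 p.1 - ψ.1 p.2) /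
        ‖p.1 - p.2‖ ^ ((N : ℝ) + 2 * (s : ℝ)))).aestronglyMeasurable
  · have hden : 0 ≤ ‖p.1 - p.2‖ ^ ((N : ℝ) + 2 * (s : ℝ)) := by positivity
    rw [norm_div, Real.norm_of_nonneg hden, Pi.add_apply, ← add_div]
    refine div_le_div_of_nonneg_right ?_ hden
    rw [Real.norm_eq_abs, abs_le]
    constructor <;> nlinarith [sq_nonneg (φ.1 p.1 - φ.1 p.2 + (ψ.1 p.1 - ψ.1 p.2)),
      sq_nonneg (φ.1 p.1 - φ.1 p.2 - (ψ.1 p.1 - ψ.1 p.2)), sq_nonneg (φ.1 p.1 - φ.1 p.2),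
      sq_nonneg (ψ.1 p.1 - ψ.1 p.2)]

/-- The Gagliardo form is a positive semi-definite inner product on `C_c^∞(ℝ^N)`. -/
instance gagliardoCore (N : ℕ) [NeZero N] (s : Ioo (0 : ℝ) 1) :
    PreInnerProductSpace.Core ℝ (TestFun N s) where
  inner φ ψ := gagliardo N s φ ψ
  conj_inner_symm φ ψ := by
    simp only [gagliardo, conj_trivial]
    simp_rw [mul_comm (ψ.1 _ - ψ.1 _)]
  re_inner_nonneg φ := by
    refine mul_nonneg (div_nonneg (fracConst_nonneg N s) zero_le_two)
      (integral_nonneg fun p => ?_)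
    exact div_nonneg (mul_self_nonneg _) (by positivity)
  add_left φ ψ χ := by
    simp only [gagliardo]
    rw [← mul_add, ← integral_add (integrable_gagliardo N s φ χ) (integrable_gagliardo N s ψ χ)]
    congr 2
    funext p
    change ((φ.1 p.1 + ψ.1 p.1) - (φ.1 p.2 + ψ.1 p.2)) * _ / _ = _
    ring
  smul_left φ ψ c := by
    simp only [gagliardo, conj_trivial]
    rw [mul_left_comm, ← integral_const_mul c]
    congr 2
    funext p
    change (c * φ.1 p.1 - c * φ.1 p.2) * _ / _ = _
    ring

/-- `C_c^∞(ℝ^N)` with the Gagliardo semi-norm. -/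
instance (N : ℕ) [NeZero N] (s : Ioo (0 : ℝ) 1) : SeminormedAddCommGroup (TestFun N s) :=
  InnerProductSpace.Core.toSeminormedAddCommGroup (𝕜 := ℝ)

instance (N : ℕ) [NeZero N] (s : Ioo (0 : ℝ) 1) : InnerProductSpace ℝ (TestFun N s) :=
  InnerProductSpace.ofCore (gagliardoCore N s)

/-- The homogeneous fractional Sobolev space `Ḣ^s(ℝ^N)`: the Hilbert space that is the completion
of `C_c^∞(ℝ^N)` under the Gagliardo semi-norm. -/
abbrev HDot (N : ℕ) [NeZero N] (s : Ioo (0 : ℝ) 1) : Type :=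
  UniformSpace.Completion (TestFun N s)

/-- The measure `w dx` on `ℝ^N`. -/
def weightMeasure {N : ℕ} (w : RN N → ℝ) : Measure (RN N) :=
  volume.withDensity fun x => ENNReal.ofReal (w x)

/-- The weighted space `L²_w(ℝ^N)`, with `⟪f, g⟫ = ∫ f g w dx`. -/
abbrev L2w {N : ℕ} (w : RN N → ℝ) : Type := Lp ℝ 2 (weightMeasure w)

/-- The critical Hardy-Sobolev exponent `2^*_s(t) = 2 (N - t) / (N - 2s)`. -/
def critExp (N : ℕ) (s t : ℝ) : ℝ := 2 * (N - t) / (N - 2 * s)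

/-- The bounded operator `i : Ḣ^s(ℝ^N) → L²_w(ℝ^N)` extends the inclusion `φ ↦ φ` of
`C_c^∞(ℝ^N)`. -/
def ExtendsInclusion {N : ℕ} [NeZero N] {s : Ioo (0 : ℝ) 1} {w : RN N → ℝ}
    (i : HDot N s →L[ℝ] L2w w) : Prop :=
  ∀ φ : TestFun N s, (i (φ : HDot N s) : RN N → ℝ) =ᵐ[weightMeasure w] φ

/-- `((-Δ)^s / w) v = f`: the function `v ∈ Ḣ^s(ℝ^N)` is a weak solution of `(-Δ)^s v = f w` in
`ℝ^N`, that is, `⟪v, φ⟫ = ∫ f φ w dx` in `Ḣ^s(ℝ^N)` for every `φ ∈ C_c^∞(ℝ^N)`. -/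
def IsWeakSolution {N : ℕ} [NeZero N] {s : Ioo (0 : ℝ) 1} {w : RN N → ℝ}
    (v : HDot N s) (f : L2w w) : Prop :=
  ∀ φ : TestFun N s, ⟪v, (φ : HDot N s)⟫ = ∫ x, f x * φ x * w x

/-- The spectrum of the bounded operator `A` is discrete away from `0`: apart from `0` it consists
of eigenvalues of finite multiplicity, which accumulate at most at `0`. -/
def HasDiscreteSpectrum {H : Type*} [NormedAddCommGroup H] [InnerProductSpace ℝ H]
    (A : H →L[ℝ] H) : Prop :=
  (∀ ε : ℝ, 0 < ε → {μ ∈ spectrum ℝ A | ε ≤ |μ|}.Finite) ∧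
  ∀ μ ∈ spectrum ℝ A, μ ≠ 0 →
    Module.End.HasEigenvalue (A : H →ₗ[ℝ] H) μ ∧
    FiniteDimensional ℝ (Module.End.eigenspace (A : H →ₗ[ℝ] H) μ)

end

/-!
Write `E(φ) = ∬ (φ(x) - φ(y))² / |x - y|^(N+2s) dx dy`; on test functions it is a positive multiple
of the square of the norm of `Ḣ^s` (`TestFun.gagliardoEnergy_eq`; that the factor is positive and
finite is `fracConst_pos`).

*Boundedness.* Everything rests on `∫ φ² w ≤ C ‖|x|^α w‖_q E(φ)` with `α = 2t / 2^*_s(t)` and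
`q = (N - t) / (2s - t)` (`weighted_hardy_sobolev`). By Hölder's inequality it follows from the
Hardy inequality `∫ φ² |x|^(-2s) ≤ C E(φ)` and the Sobolev inequality
`‖φ‖²_{2N/(N-2s)} ≤ C E(φ)`. Both come from the same comparison of `φ(x)²` with the mean of `φ²`
over a set at a controlled distance from `x` (`volume_mul_sq_le`). For Hardy (`fractional_hardy`)
the set is a ball about the origin with radius a large multiple of `|x|`, and the mean is absorbed
in the left-hand side. For Sobolev (`fractional_sobolev`) it is a ball about `x` just large enough
for the mean of `φ²` to be at most `φ(x)² / 4`, which leaves a pointwise bound for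
`|φ(x)|^(2N/(N-2s))` by the energy density at `x`.

*Injectivity.* A sequence that is Cauchy in `Ḣ^s` and tends to zero in `L²_w` tends to zero almost
everywhere along a subsequence, because `w > 0`, and Fatou's lemma shows that its energy tends to
zero (`ExtendsInclusion.injective`).

*Compactness.* As `q < ∞`, the weight may be cut down to a bounded one on a ball.
There a Poincaré inequality on the cubes of a fine grid bounds the `L²` norm by a small multiple of
the energy and the means over finitely many cubes (`setIntegral_ball_sq_le`,
`lintegral_sq_mul_weight_le`). So the embedding has small norm on a closed subspace of finite
codimension, and an operator with this property for every bound is compact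
(`isCompactOperator_of_small_on_ker`).

*The inverse.* The weak equation `⟪v, φ⟫ = ∫ f φ w = ⟪f, i φ⟫` for all `φ` says that `v` is the
value at `f` of the adjoint of `i`. Hence `T = i†`, it is injective because test functions are total
in `L²_w`, and `i ∘ T = i i†` is compact and self-adjoint. Its spectrum is described by the Fredholm
alternative and the orthogonality of eigenvectors (`hasDiscreteSpectrum_of_isCompactOperator`).
-/

/-! ### Compact operators on Hilbert spaces -/

/-- Nonzero spectral values are eigenvalues by the Fredholm alternative. They accumulate only at
zero, as `A` would map an orthonormal sequence of eigenvectors with eigenvalues bounded away from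
zero to a sequence without convergent subsequences. -/
theorem hasDiscreteSpectrum_of_isCompactOperator {H : Type*} [NormedAddCommGroup H]
    [InnerProductSpace ℝ H] [CompleteSpace H] {A : H →L[ℝ] H} (hc : IsCompactOperator A)
    (hA : IsSelfAdjoint A) : HasDiscreteSpectrum A := by
  have hsymm : (A : H →ₗ[ℝ] H).IsSymmetric := hA.isSymmetric
  have heig : ∀ μ ∈ spectrum ℝ A, μ ≠ 0 → Module.End.HasEigenvalue (A : H →ₗ[ℝ] H) μ :=
    fun μ hμ h0 => (hc.hasEigenvalue_iff_mem_spectrum h0).2 hμ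
  refine ⟨fun ε hε => ?_, fun μ hμ h0 =>
    ⟨heig μ hμ h0, ContinuousLinearMap.finite_dimensional_eigenspace hc μ h0⟩⟩
  by_contra hinf
  -- Otherwise there are orthonormal eigenvectors `e n` whose images are `ε`-separated.
  let m : ℕ ↪ {μ ∈ spectrum ℝ A | ε ≤ |μ|} := Set.Infinite.natEmbedding _ hinf
  have hm0 : ∀ n, (m n : ℝ) ≠ 0 := fun n h => by
    have := (m n).2.2
    rw [h, abs_zero] at this
    linarith
  have hex : ∀ n, ∃ v : H, A v = (m n : ℝ) • v ∧ ‖v‖ = 1 := by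
    intro n
    obtain ⟨v, hv⟩ := (heig _ (m n).2.1 (hm0 n)).exists_hasEigenvector
    have hv0 : ‖v‖ ≠ 0 := norm_ne_zero_iff.2 hv.2
    refine ⟨‖v‖⁻¹ • v, ?_, by rw [norm_smul, norm_inv, norm_norm, inv_mul_cancel₀ hv0]⟩
    have : A v = (m n : ℝ) • v := hv.apply_eq_smul
    rw [map_smul, this, smul_comm]
  choose e he he1 using hex
  have horth : ∀ j k, j ≠ k → ⟪e j, e k⟫ = 0 := by
    intro j k hjk
    have h1 : ⟪A (e j), e k⟫ = ⟪e j, A (e k)⟫ := hsymm (e j) (e k)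
    rw [he, he, real_inner_smul_left, real_inner_smul_right] at h1
    have h2 : (m j : ℝ) ≠ m k := fun h => hjk (m.injective (Subtype.ext h))
    have h3 : ((m j : ℝ) - m k) * ⟪e j, e k⟫ = 0 := by linear_combination h1
    exact (mul_eq_zero.1 h3).resolve_left (sub_ne_zero.2 h2)
  have hsep : ∀ j k, j ≠ k → ε ≤ ‖A (e j) - A (e k)‖ := by
    intro j k hjk
    refine le_of_sq_le_sq ?_ (norm_nonneg _)
    rw [@norm_sub_sq_real, he, he, real_inner_smul_left, real_inner_smul_right, horth j k hjk,
      norm_smul, norm_smul, he1, he1, Real.norm_eq_abs, Real.norm_eq_abs]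
    have h1 : ε ≤ |(m j : ℝ)| := (m j).2.2
    nlinarith [sq_nonneg |(m k : ℝ)|]
  obtain ⟨K, hK, hK'⟩ := hc.image_closedBall_subset_compact (𝕜₁ := ℝ) 1
  obtain ⟨y, -, ψ, hψ, hψy⟩ :=
    hK.tendsto_subseq (fun n => hK' ⟨e n, by simp [he1], rfl⟩)
  obtain ⟨n, hn⟩ := Metric.cauchySeq_iff'.1 hψy.cauchySeq ε hε
  have h1 := hn (n + 1) (Nat.le_succ n)
  simp only [Function.comp, dist_eq_norm] at h1
  exact absurd h1 (not_lt.2 (hsep _ _ (hψ.injective.ne (Nat.succ_ne_self n))))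

/-- An operator on a Hilbert space is compact if its restrictions to suitable closed subspaces of
finite codimension have arbitrarily small norm. -/
theorem isCompactOperator_of_small_on_ker {H F : Type*} [NormedAddCommGroup H]
    [InnerProductSpace ℝ H] [CompleteSpace H] [NormedAddCommGroup F] [NormedSpace ℝ F]
    [CompleteSpace F] {i : H →L[ℝ] F}
    (h : ∀ ε : ℝ, 0 < ε → ∃ (n : ℕ) (L : H →L[ℝ] (Fin n → ℝ)),
      ∀ u, L u = 0 → ‖i u‖ ≤ ε * ‖u‖) : IsCompactOperator i := by
  refine isClosed_setOfPred_isCompactOperator.closure_subset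
    (Metric.mem_closure_iff.2 fun ε hε => ?_)
  obtain ⟨n, L, hL⟩ := h (ε / 2) (half_pos hε)
  set K : Submodule ℝ H := (L : H →ₗ[ℝ] (Fin n → ℝ)).ker with hK
  have hKc : IsClosed (K : Set H) := L.isClosed_ker
  have : CompleteSpace K := hKc.completeSpace_coe
  -- `i` agrees with the finite rank operator `i ∘ (1 - P)` up to an operator of norm at most `ε/2`,
  -- where `P` is the orthogonal projection onto the kernel.
  have : FiniteDimensional ℝ Kᗮ := by
    refine FiniteDimensional.of_injective ((L : H →ₗ[ℝ] (Fin n → ℝ)) ∘ₗ Kᗮ.subtype) ?_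
    rw [← LinearMap.ker_eq_bot, LinearMap.ker_eq_bot']
    intro v hv
    have h1 : (v : H) ∈ K := hv
    exact Subtype.ext ((Submodule.mem_bot ℝ).1 (K.inf_orthogonal_eq_bot ▸ ⟨h1, v.2⟩))
  refine ⟨i ∘L Kᗮ.starProjection, ?_, ?_⟩
  · have h1 : IsCompactOperator (id : Kᗮ → Kᗮ) :=
      (isCompactOperator_id_iff_finiteDimensional (𝕜 := ℝ)).2 inferInstance
    exact (h1.comp_clm Kᗮ.orthogonalProjectionOnto).clm_comp (i ∘L Kᗮ.subtypeL)
  · rw [dist_eq_norm]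
    refine lt_of_le_of_lt (ContinuousLinearMap.opNorm_le_bound _ (half_pos hε).le fun u => ?_)
      (half_lt_self hε)
    have h1 : (i - i ∘L Kᗮ.starProjection) u = i (K.starProjection u) := by
      rw [Submodule.starProjection_orthogonal]
      simp
    rw [h1]
    refine (hL _ (K.starProjection_apply_mem u)).trans ?_
    exact mul_le_mul_of_nonneg_left (K.norm_starProjection_apply_le u) (half_pos hε).le

/-! ### The fractional Hardy inequality -/

/-- The energy density `∫ (φ(x) - φ(y))² / |x - y|^(N+2s) dy` at the point `x`. -/
noncomputable def gagliardoDensity (N : ℕ) (s : ℝ) (φ : RN N → ℝ) (x : RN N) : ENNReal :=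
  ∫⁻ y, ENNReal.ofReal ((φ x - φ y) ^ 2 / ‖x - y‖ ^ ((N : ℝ) + 2 * s))

/-- The Gagliardo energy `∬ (φ(x) - φ(y))² / |x - y|^(N+2s) dx dy`, possibly infinite. -/
noncomputable def gagliardoEnergy (N : ℕ) (s : ℝ) (φ : RN N → ℝ) : ENNReal :=
  ∫⁻ x, gagliardoDensity N s φ x

theorem measurable_gagliardoDensity (N : ℕ) (s : ℝ) {φ : RN N → ℝ} (hφ : Measurable φ) :
    Measurable (gagliardoDensity N s φ) := by
  refine Measurable.lintegral_prod_right' (f := fun p : RN N × RN N =>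
    ENNReal.ofReal ((φ p.1 - φ p.2) ^ 2 / ‖p.1 - p.2‖ ^ ((N : ℝ) + 2 * s))) ?_
  fun_prop

/-- Compare `φ(x)` with the values of `φ` on a set `B` near `x`; the error is controlled by the
energy density at `x`. -/
theorem volume_mul_sq_le {N : ℕ} {s : ℝ} (hs : 0 < s) {φ : RN N → ℝ} (hφ : Measurable φ)
    {B : Set (RN N)} {ρ : ℝ} (x : RN N) (hρ : ∀ y ∈ B, ‖x - y‖ ≤ ρ)
    (hB : MeasurableSet B) :
    volume B * ENNReal.ofReal (φ x ^ 2) ≤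
      ENNReal.ofReal 2 * (∫⁻ y in B, ENNReal.ofReal (φ y ^ 2)) +
      ENNReal.ofReal 2 * ENNReal.ofReal (ρ ^ ((N : ℝ) + 2 * s)) * gagliardoDensity N s φ x := by
  set e : ℝ := (N : ℝ) + 2 * s with he
  have he0 : 0 < e := by positivity
  have hm : Measurable fun y => ENNReal.ofReal ((φ x - φ y) ^ 2 / ‖x - y‖ ^ e) := by fun_prop
  calc volume B * ENNReal.ofReal (φ x ^ 2)
      = ∫⁻ y in B, ENNReal.ofReal (φ x ^ 2) := by rw [setLIntegral_const, mul_comm]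
    _ ≤ ∫⁻ y in B, (ENNReal.ofReal 2 * ENNReal.ofReal (φ y ^ 2) +
          ENNReal.ofReal 2 * ENNReal.ofReal (ρ ^ e) *
          ENNReal.ofReal ((φ x - φ y) ^ 2 / ‖x - y‖ ^ e)) := by
        refine setLIntegral_mono' hB fun y hy => ?_
        have hq : 0 ≤ (φ x - φ y) ^ 2 / ‖x - y‖ ^ e := by positivity
        have hρ0 : 0 ≤ ρ := (norm_nonneg _).trans (hρ y hy)
        rw [← ENNReal.ofReal_mul zero_le_two, ← ENNReal.ofReal_mul zero_le_two,
          ← ENNReal.ofReal_mul (by positivity), ← ENNReal.ofReal_add (by positivity)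
            (by positivity)]
        refine ENNReal.ofReal_le_ofReal ?_
        have h1 : (φ x - φ y) ^ 2 ≤ ρ ^ e * ((φ x - φ y) ^ 2 / ‖x - y‖ ^ e) := by
          rcases eq_or_ne x y with rfl | hxy
          · simp
          · have hpos : 0 < ‖x - y‖ ^ e :=
              Real.rpow_pos_of_pos (norm_pos_iff.2 (sub_ne_zero.2 hxy)) _
            rw [← mul_div_assoc, le_div_iff₀ hpos, mul_comm]
            exact mul_le_mul_of_nonneg_right
              (Real.rpow_le_rpow (norm_nonneg _) (hρ y hy) he0.le) (sq_nonneg _)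
        nlinarith [sq_nonneg (φ x - 2 * φ y)]
    _ = ENNReal.ofReal 2 * (∫⁻ y in B, ENNReal.ofReal (φ y ^ 2)) +
          ENNReal.ofReal 2 * ENNReal.ofReal (ρ ^ e) *
          ∫⁻ y in B, ENNReal.ofReal ((φ x - φ y) ^ 2 / ‖x - y‖ ^ e) := by
        rw [lintegral_add_right _ (by fun_prop), lintegral_const_mul _ (by fun_prop),
          lintegral_const_mul _ hm]
    _ ≤ _ := by
        gcongr
        exact setLIntegral_le_lintegral _ _

/-- The volume of the unit ball. -/
noncomputable def unitBallVolume (N : ℕ) : ℝ := volume.real (Metric.ball (0 : RN N) 1)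

theorem unitBallVolume_pos (N : ℕ) : 0 < unitBallVolume N :=
  ENNReal.toReal_pos (Metric.measure_ball_pos _ _ one_pos).ne' measure_ball_lt_top.ne

theorem volume_ball_eq (N : ℕ) (x : RN N) {r : ℝ} (hr : 0 < r) :
    volume (Metric.ball x r) = ENNReal.ofReal (unitBallVolume N * r ^ (N : ℝ)) := by
  rw [Measure.addHaar_ball_of_pos _ _ hr, mul_comm, ENNReal.ofReal_mul (unitBallVolume_pos N).le,
    unitBallVolume, Measure.real, ENNReal.ofReal_toReal measure_ball_lt_top.ne]
  simp

/-- Integration in polar coordinates: `∫_{|x| > R} |x|^(-N-2s) dx = N |B₁| R^(-2s) / (2s)`. -/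
theorem lintegral_norm_rpow_compl_ball (N : ℕ) [NeZero N] {s R : ℝ} (hs : 0 < s) (hR : 0 < R) :
    ∫⁻ x in {x : RN N | R < ‖x‖}, ENNReal.ofReal (‖x‖ ^ (-((N : ℝ) + 2 * s))) =
      ENNReal.ofReal (N * unitBallVolume N * (R ^ (-(2 * s)) / (2 * s))) := by
  have hN : 1 ≤ N := Nat.one_le_iff_ne_zero.2 (NeZero.ne N)
  set f : ℝ → ℝ := (Ioi R).indicator fun r => r ^ (-((N : ℝ) + 2 * s)) with hf
  have hf0 : ∀ r, 0 ≤ f r := fun r => indicator_nonneg (fun r hr =>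
    Real.rpow_nonneg (hR.le.trans (le_of_lt hr)) _) r
  have hset : MeasurableSet {x : RN N | R < ‖x‖} :=
    measurableSet_lt measurable_const measurable_norm
  have hdim : Module.finrank ℝ (RN N) = N := by simp
  have hpt : ∀ r ∈ Ioi (0 : ℝ), r ^ (Module.finrank ℝ (RN N) - 1) • f r
      = (Ioi R).indicator (fun r => r ^ (-1 - 2 * s)) r := by
    intro r hr
    have hr0 : (0 : ℝ) < r := hr
    by_cases h : r ∈ Ioi R
    · rw [hf, indicator_of_mem h, indicator_of_mem h, hdim, smul_eq_mul, ← Real.rpow_natCast,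
        ← Real.rpow_add hr0, Nat.cast_sub hN, Nat.cast_one]
      congr 1
      ring
    · rw [hf, indicator_of_notMem h, indicator_of_notMem h, smul_zero]
  have hint : Integrable (fun x : RN N => f ‖x‖) := by
    rw [integrable_fun_norm_addHaar (μ := (volume : Measure (RN N))) (f := f),
      integrableOn_congr_fun hpt measurableSet_Ioi]
    refine Integrable.integrableOn ?_
    rw [integrable_indicator_iff measurableSet_Ioi]
    exact integrableOn_Ioi_rpow_of_lt (by linarith) hR
  have hval : ∫ x : RN N, f ‖x‖ = N * unitBallVolume N * (R ^ (-(2 * s)) / (2 * s)) := by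
    rw [integral_fun_norm_addHaar, setIntegral_congr_fun measurableSet_Ioi hpt, hdim,
      setIntegral_indicator measurableSet_Ioi, Ioi_inter_Ioi, max_eq_right hR.le,
      integral_Ioi_rpow_of_lt (by linarith) hR, nsmul_eq_mul, smul_eq_mul,
      unitBallVolume, mul_assoc]
    have : -1 - 2 * s + 1 = -(2 * s) := by ring
    rw [this, neg_div_neg_eq]
  rw [← hval, ofReal_integral_eq_lintegral_ofReal hint (Filter.Eventually.of_forall fun x => hf0 _),
    ← lintegral_indicator hset]
  refine lintegral_congr fun x => ?_
  by_cases h : R < ‖x‖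
  · rw [indicator_of_mem (show x ∈ {x : RN N | R < ‖x‖} from h), hf,
      indicator_of_mem (show ‖x‖ ∈ Ioi R from h)]
  · rw [indicator_of_notMem (show x ∉ {x : RN N | R < ‖x‖} from h), hf,
      indicator_of_notMem (show ‖x‖ ∉ Ioi R from h), ENNReal.ofReal_zero]

/-- The **fractional Hardy inequality**. The value at `x` is compared with the mean over the ball
of radius `Λ|x|` about the origin; when `Λ` is large, the mean contributes at most half of the
left-hand side, since `2s < N`. -/
theorem fractional_hardy (N : ℕ) [NeZero N] {s : ℝ} (hs : 0 < s) (hsN : 2 * s < N) :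
    ∃ C : NNReal, ∀ φ : RN N → ℝ, Measurable φ →
      ∫⁻ x, ENNReal.ofReal (φ x ^ 2 * ‖x‖ ^ (-(2 * s))) ≠ ⊤ →
      ∫⁻ x, ENNReal.ofReal (φ x ^ 2 * ‖x‖ ^ (-(2 * s))) ≤ C * gagliardoEnergy N s φ := by
  have hN0 : (0 : ℝ) < N := by linarith
  set β := unitBallVolume N with hβ
  have hβ0 : 0 < β := unitBallVolume_pos N
  set e : ℝ := (N : ℝ) + 2 * s with he
  -- With this `Λ` the mean contributes exactly half of the left-hand side, see `hhalf`.
  set Λ : ℝ := (2 * N / s) ^ (1 / ((N : ℝ) - 2 * s)) with hΛ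
  have hΛ0 : 0 < Λ := by positivity
  have hΛN : (0 : ℝ) < Λ ^ (N : ℝ) := Real.rpow_pos_of_pos hΛ0 _
  set b : ℝ := 2 * (Λ + 1) ^ e / (β * Λ ^ (N : ℝ)) with hb
  have hb0 : 0 ≤ b := by positivity
  refine ⟨(2 * b).toNNReal, fun φ hφ hfin => ?_⟩
  set H := ∫⁻ x, ENNReal.ofReal (φ x ^ 2 * ‖x‖ ^ (-(2 * s))) with hH
  have hne : ∀ᵐ x : RN N, x ≠ 0 := Measure.ae_ne volume 0
  set a : ℝ := 2 / (β * Λ ^ (N : ℝ)) with ha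
  have hpt : ∀ᵐ x : RN N, ENNReal.ofReal (φ x ^ 2 * ‖x‖ ^ (-(2 * s))) ≤
      ENNReal.ofReal a * (ENNReal.ofReal (‖x‖ ^ (-e)) *
        ∫⁻ y in Metric.ball 0 (Λ * ‖x‖), ENNReal.ofReal (φ y ^ 2)) +
      ENNReal.ofReal b * gagliardoDensity N s φ x := by
    filter_upwards [hne] with x hx
    have hx0 : 0 < ‖x‖ := norm_pos_iff.2 hx
    have h1 := volume_mul_sq_le (s := s) hs hφ (B := Metric.ball 0 (Λ * ‖x‖))
      (ρ := (Λ + 1) * ‖x‖) x (fun y hy => by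
        have : ‖y‖ < Λ * ‖x‖ := by simpa using hy
        linarith [norm_sub_le x y]) measurableSet_ball
    rw [volume_ball_eq N 0 (by positivity)] at h1
    set I := ∫⁻ y in Metric.ball 0 (Λ * ‖x‖), ENNReal.ofReal (φ y ^ 2)
    set D := gagliardoDensity N s φ x
    set κ : ℝ := ‖x‖ ^ (-e) / (β * Λ ^ (N : ℝ)) with hκ
    have hκ0 : 0 ≤ κ := by positivity
    have e1 : ‖x‖ ^ (-e) * ‖x‖ ^ e = 1 := by
      rw [← Real.rpow_add hx0, neg_add_cancel, Real.rpow_zero]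
    have e2 : ‖x‖ ^ (-e) * ‖x‖ ^ (N : ℝ) = ‖x‖ ^ (-(2 * s)) := by
      rw [← Real.rpow_add hx0]; congr 1; rw [he]; ring
    calc ENNReal.ofReal (φ x ^ 2 * ‖x‖ ^ (-(2 * s)))
        = ENNReal.ofReal κ * (ENNReal.ofReal (β * (Λ * ‖x‖) ^ (N : ℝ)) *
            ENNReal.ofReal (φ x ^ 2)) := by
          rw [← ENNReal.ofReal_mul (by positivity), ← ENNReal.ofReal_mul hκ0]
          congr 1
          rw [hκ, Real.mul_rpow hΛ0.le hx0.le, ← e2]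
          field_simp
      _ ≤ ENNReal.ofReal κ * (ENNReal.ofReal 2 * I +
            ENNReal.ofReal 2 * ENNReal.ofReal (((Λ + 1) * ‖x‖) ^ e) * D) := by
          gcongr
      _ = ENNReal.ofReal a * (ENNReal.ofReal (‖x‖ ^ (-e)) * I) + ENNReal.ofReal b * D := by
          rw [mul_add, ← mul_assoc, ← mul_assoc, ← mul_assoc, ← ENNReal.ofReal_mul hκ0,
            ← ENNReal.ofReal_mul (by positivity), ← mul_assoc, ← ENNReal.ofReal_mul (by positivity)]
          congr 3
          · rw [hκ, ha]; ring
          · rw [hκ, hb, Real.mul_rpow (by positivity) hx0.le]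
            field_simp
            linear_combination e1
  have hDm := measurable_gagliardoDensity N s hφ
  -- By Tonelli, the integral of the means is a multiple of the left-hand side itself.
  have hswap : ∫⁻ x : RN N, ENNReal.ofReal (‖x‖ ^ (-e)) *
        ∫⁻ y in Metric.ball 0 (Λ * ‖x‖), ENNReal.ofReal (φ y ^ 2)
      = ENNReal.ofReal (N * β * (Λ ^ (2 * s) / (2 * s))) * H := by
    set k : RN N → RN N → ENNReal := fun x y =>
      {p : RN N × RN N | ‖p.2‖ < Λ * ‖p.1‖}.indicator
        (fun p => ENNReal.ofReal (‖p.1‖ ^ (-e)) * ENNReal.ofReal (φ p.2 ^ 2)) (x, y) with hk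
    have hkm : Measurable (Function.uncurry k) := by
      refine Measurable.indicator (f := fun p : RN N × RN N =>
        ENNReal.ofReal (‖p.1‖ ^ (-e)) * ENNReal.ofReal (φ p.2 ^ 2)) (by fun_prop) ?_
      exact measurableSet_lt (by fun_prop) (by fun_prop)
    have h1 : ∀ x : RN N, ENNReal.ofReal (‖x‖ ^ (-e)) *
        ∫⁻ y in Metric.ball 0 (Λ * ‖x‖), ENNReal.ofReal (φ y ^ 2) = ∫⁻ y, k x y := by
      intro x
      rw [← lintegral_const_mul _ (by fun_prop), ← lintegral_indicator measurableSet_ball]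
      refine lintegral_congr fun y => ?_
      simp only [hk, indicator, mem_ball_zero_iff, mem_ofPred_eq]
    simp_rw [h1]
    rw [lintegral_lintegral_swap hkm.aemeasurable, hH, ← lintegral_const_mul _ (by fun_prop)]
    refine lintegral_congr_ae ?_
    filter_upwards [hne] with y hy
    have hy0 : 0 < ‖y‖ := norm_pos_iff.2 hy
    have h2 : ∀ x : RN N, k x y = ENNReal.ofReal (φ y ^ 2) *
        {x : RN N | ‖y‖ / Λ < ‖x‖}.indicator (fun x => ENNReal.ofReal (‖x‖ ^ (-e))) x := by
      intro x
      simp only [hk, indicator, mem_ofPred_eq, div_lt_iff₀' hΛ0]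
      split_ifs
      · rw [mul_comm]
      · rw [mul_zero]
    simp_rw [h2]
    have hset : MeasurableSet {x : RN N | ‖y‖ / Λ < ‖x‖} :=
      measurableSet_lt measurable_const measurable_norm
    rw [lintegral_const_mul _ (Measurable.indicator (by fun_prop) hset),
      lintegral_indicator hset, lintegral_norm_rpow_compl_ball N hs (by positivity),
      ← ENNReal.ofReal_mul (sq_nonneg _), ← ENNReal.ofReal_mul (by positivity)]
    congr 1
    rw [Real.div_rpow hy0.le hΛ0.le, Real.rpow_neg hΛ0.le, div_inv_eq_mul]
    ring
  have hhalf : a * (N * β * (Λ ^ (2 * s) / (2 * s))) = 1 / 2 := by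
    have h3 : Λ ^ (N : ℝ) = Λ ^ (2 * s) * (2 * N / s) := by
      have : (N : ℝ) = 2 * s + (N - 2 * s) := by ring
      conv_lhs => rw [this, Real.rpow_add hΛ0]
      congr 1
      rw [hΛ, ← Real.rpow_mul (by positivity), one_div_mul_cancel (by linarith), Real.rpow_one]
    have : 0 < Λ ^ (2 * s) := Real.rpow_pos_of_pos hΛ0 _
    rw [ha, h3]
    field_simp
  have key : H ≤ ENNReal.ofReal (1 / 2) * H + ENNReal.ofReal b * gagliardoEnergy N s φ := by
    calc H ≤ _ := lintegral_mono_ae hpt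
      _ = _ := by
        rw [lintegral_add_right _ (hDm.const_mul _), lintegral_const_mul' _ _ ENNReal.ofReal_ne_top,
          hswap, lintegral_const_mul _ hDm, ← mul_assoc, ← ENNReal.ofReal_mul (by positivity),
          hhalf]
        rfl
  -- Absorb the mean; this needs the left-hand side to be finite.
  have hsplit : H = ENNReal.ofReal (1 / 2) * H + ENNReal.ofReal (1 / 2) * H := by
    rw [← add_mul, ← ENNReal.ofReal_add (by norm_num) (by norm_num)]
    norm_num
  have hle : ENNReal.ofReal (1 / 2) * H ≤ ENNReal.ofReal b * gagliardoEnergy N s φ := by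
    refine (ENNReal.add_le_add_iff_left
      (ENNReal.mul_ne_top ENNReal.ofReal_ne_top hfin : ENNReal.ofReal (1 / 2) * H ≠ ⊤)).1 ?_
    rw [← hsplit]
    exact key
  calc H = ENNReal.ofReal 2 * (ENNReal.ofReal (1 / 2) * H) := by
        rw [← mul_assoc, ← ENNReal.ofReal_mul zero_le_two]
        norm_num
    _ ≤ ENNReal.ofReal 2 * (ENNReal.ofReal b * gagliardoEnergy N s φ) := by gcongr
    _ = _ := by
        rw [← mul_assoc, ← ENNReal.ofReal_mul zero_le_two]
        rfl

/-! ### The fractional Sobolev inequality -/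

/-- Pointwise bound behind the Sobolev inequality: with `S = ∫ |φ|^p`, `p = 2N/(N-2s)`, one has
`|φ(x)|^p ≤ C S^(2s/N) ∫ (φ(x) - φ(y))² / |x - y|^(N+2s) dy`. It comes from comparing `φ(x)` with
its mean over the ball about `x` on which, by Hölder's inequality, the mean square of `φ` is at
most `φ(x)² / 4`. -/
theorem rpow_le_gagliardoDensity (N : ℕ) {s : ℝ} (hs : 0 < s) (hsN : 2 * s < N) :
    ∃ C : NNReal, ∀ φ : RN N → ℝ, Measurable φ → ∀ S : ℝ, 0 < S →
      ∫⁻ y, ENNReal.ofReal (|φ y| ^ (2 * N / (N - 2 * s))) = ENNReal.ofReal S → ∀ x,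
      ENNReal.ofReal (|φ x| ^ (2 * N / (N - 2 * s))) ≤
        C * ENNReal.ofReal (S ^ (2 * s / N)) * gagliardoDensity N s φ x := by
  have hN0 : (0 : ℝ) < N := by linarith
  have hNs : (0 : ℝ) < N - 2 * s := by linarith
  set β := unitBallVolume N with hβ
  have hβ0 : 0 < β := unitBallVolume_pos N
  set p : ℝ := 2 * N / (N - 2 * s) with hp
  have hp0 : 0 < p := by positivity
  set θ : ℝ := (N - 2 * s) / N with hθ
  have hθ0 : 0 < θ := by positivity
  have hθ1 : 1 - θ = 2 * s / N := by rw [hθ]; field_simp; ring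
  have hpθ : p * θ = 2 := by rw [hp, hθ]; field_simp
  set c : ℝ := 4 / β * (4 ^ (p / 2) / β) ^ (2 * s / (N : ℝ)) with hc
  have hc0 : 0 < c := by positivity
  refine ⟨c.toNNReal, fun φ hφ S hS hint x => ?_⟩
  rcases eq_or_ne (φ x) 0 with h0 | h0
  · rw [h0, abs_zero, Real.zero_rpow hp0.ne', ENNReal.ofReal_zero]
    exact zero_le
  have hφx : 0 < |φ x| := abs_pos.2 h0
  set D := gagliardoDensity N s φ x with hD
  set P : ℝ := |φ x| ^ p with hP
  have hP0 : 0 < P := Real.rpow_pos_of_pos hφx _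
  have hPθ : P ^ θ = φ x ^ 2 := by
    rw [hP, ← Real.rpow_mul hφx.le, hpθ, Real.rpow_two, sq_abs]
  -- The volume of the ball is such that Hölder's bound for the mean of `φ²` is `φ(x)² / 4`.
  set V : ℝ := S * 4 ^ (p / 2) / P with hV
  have hV0 : 0 < V := by positivity
  set r : ℝ := (V / β) ^ (1 / (N : ℝ)) with hr
  have hr0 : 0 < r := by positivity
  have hrN : β * r ^ (N : ℝ) = V := by
    rw [hr, ← Real.rpow_mul (by positivity), one_div_mul_cancel hN0.ne', Real.rpow_one]
    field_simp
  have h1 := volume_mul_sq_le hs hφ (B := Metric.ball x r) (ρ := r) x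
    (fun y hy => by rw [← dist_eq_norm, dist_comm]; exact (Metric.mem_ball.1 hy).le)
    measurableSet_ball
  have hvol : volume (Metric.ball x r) = ENNReal.ofReal V := by
    rw [volume_ball_eq N x hr0, ← hβ, hrN]
  have hSV : S ^ θ * V ^ (1 - θ) = V * φ x ^ 2 / 4 := by
    have e1 : S = V * (P / 4 ^ (p / 2)) := by rw [hV]; field_simp
    have e2 : ((4 : ℝ) ^ (p / 2)) ^ θ = 4 := by
      rw [← Real.rpow_mul (by norm_num), div_mul_eq_mul_div, hpθ]; norm_num
    have e3 : V ^ θ * V ^ (1 - θ) = V := by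
      rw [← Real.rpow_add hV0, add_sub_cancel, Real.rpow_one]
    conv_lhs => rw [e1]
    rw [Real.mul_rpow hV0.le (by positivity), Real.div_rpow hP0.le (by positivity), hPθ, e2]
    linear_combination (φ x ^ 2 / 4) * e3
  have hhold : ∫⁻ y in Metric.ball x r, ENNReal.ofReal (φ y ^ 2) ≤
      ENNReal.ofReal (V * φ x ^ 2 / 4) := by
    have h2 := ENNReal.lintegral_mul_norm_pow_le (μ := volume.restrict (Metric.ball x r))
      (f := fun y => ENNReal.ofReal (|φ y| ^ p)) (g := fun _ => 1) (by fun_prop) (by fun_prop)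
      hθ0.le (show 0 ≤ 1 - θ by rw [hθ1]; positivity) (by ring)
    simp only [ENNReal.one_rpow, mul_one, lintegral_one, Measure.restrict_apply_univ, hvol] at h2
    have h3 : ∀ y, ENNReal.ofReal (|φ y| ^ p) ^ θ = ENNReal.ofReal (φ y ^ 2) := by
      intro y
      rw [ENNReal.ofReal_rpow_of_nonneg (by positivity) hθ0.le, ← Real.rpow_mul (abs_nonneg _), hpθ,
        Real.rpow_two, sq_abs]
    simp_rw [h3] at h2
    refine h2.trans ?_
    rw [← hSV, ENNReal.ofReal_mul (by positivity), ← ENNReal.ofReal_rpow_of_pos hS,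
      ← ENNReal.ofReal_rpow_of_pos hV0]
    gcongr
    rw [← hint]
    exact setLIntegral_le_lintegral _ _
  rw [hvol, ← ENNReal.ofReal_mul hV0.le] at h1
  have h4 : ENNReal.ofReal (V * φ x ^ 2 / 2) ≤
      ENNReal.ofReal 2 * ENNReal.ofReal (r ^ ((N : ℝ) + 2 * s)) * D := by
    refine (ENNReal.add_le_add_iff_left
      (ENNReal.ofReal_ne_top : ENNReal.ofReal (V * φ x ^ 2 / 2) ≠ ⊤)).1 ?_
    rw [← ENNReal.ofReal_add (by positivity) (by positivity), add_halves]
    refine h1.trans ?_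
    gcongr
    calc _ ≤ ENNReal.ofReal 2 * ENNReal.ofReal (V * φ x ^ 2 / 4) := by gcongr
      _ = _ := by rw [← ENNReal.ofReal_mul zero_le_two]; congr 1; ring
  set κ : ℝ := 2 / V * P ^ (2 * s / (N : ℝ)) with hκ
  have hκ0 : 0 < κ := by positivity
  calc ENNReal.ofReal P = ENNReal.ofReal κ * ENNReal.ofReal (V * φ x ^ 2 / 2) := by
        rw [← ENNReal.ofReal_mul hκ0.le]
        congr 1
        have e1 : P ^ θ * P ^ (2 * s / (N : ℝ)) = P := by
          rw [← Real.rpow_add hP0, ← hθ1, add_sub_cancel, Real.rpow_one]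
        rw [hPθ] at e1
        rw [hκ]
        field_simp
        linear_combination -e1
    _ ≤ ENNReal.ofReal κ * (ENNReal.ofReal 2 * ENNReal.ofReal (r ^ ((N : ℝ) + 2 * s)) * D) := by
        gcongr
    _ = _ := by
        rw [← ENNReal.ofReal_mul zero_le_two, ← mul_assoc, ← ENNReal.ofReal_mul hκ0.le,
          ENNReal.ofNNReal_toNNReal, ← ENNReal.ofReal_mul hc0.le]
        congr 2
        have e1 : r ^ (2 * s) = (V / β) ^ (2 * s / (N : ℝ)) := by
          rw [hr, ← Real.rpow_mul (by positivity)]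
          congr 1
          ring
        have e2 : r ^ (N : ℝ) = V / β := by rw [← hrN]; field_simp
        have e3 : P ^ (2 * s / (N : ℝ)) * (V / β) ^ (2 * s / (N : ℝ)) =
            (4 ^ (p / 2) / β) ^ (2 * s / (N : ℝ)) * S ^ (2 * s / (N : ℝ)) := by
          rw [← Real.mul_rpow hP0.le (by positivity), ← Real.mul_rpow (by positivity) hS.le]
          congr 1
          rw [hV]
          field_simp
        rw [Real.rpow_add hr0, e1, e2, hκ, hc]
        have e4 : 2 / V * (2 * (V / β)) = 4 / β := by field_simp; norm_num
        linear_combination (2 / V * (2 * (V / β))) * e3 +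
          ((4 ^ (p / 2) / β) ^ (2 * s / (N : ℝ)) * S ^ (2 * s / (N : ℝ))) * e4

/-- The **fractional Sobolev inequality**, in the form `‖φ‖_p² ≤ C ∬ …` with
`p = 2N/(N-2s)`. -/
theorem fractional_sobolev (N : ℕ) {s : ℝ} (hs : 0 < s) (hsN : 2 * s < N) :
    ∃ C : NNReal, ∀ φ : RN N → ℝ, Measurable φ →
      ∫⁻ x, ENNReal.ofReal (|φ x| ^ (2 * N / (N - 2 * s))) ≠ ⊤ →
      (∫⁻ x, ENNReal.ofReal (|φ x| ^ (2 * N / (N - 2 * s)))) ^ ((N - 2 * s) / N) ≤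
        C * gagliardoEnergy N s φ := by
  have hN0 : (0 : ℝ) < N := by linarith
  have hNs : (0 : ℝ) < N - 2 * s := by linarith
  obtain ⟨C, hC⟩ := rpow_le_gagliardoDensity N hs hsN
  refine ⟨C, fun φ hφ hfin => ?_⟩
  set I := ∫⁻ x, ENNReal.ofReal (|φ x| ^ (2 * N / (N - 2 * s))) with hI
  have hθ0 : 0 < (N - 2 * s) / N := by positivity
  rcases eq_or_ne I 0 with h0 | h0
  · rw [h0, ENNReal.zero_rpow_of_pos hθ0]
    exact zero_le
  have hS : 0 < I.toReal := ENNReal.toReal_pos h0 hfin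
  have hIS : I = ENNReal.ofReal I.toReal := (ENNReal.ofReal_toReal hfin).symm
  set S := I.toReal
  have h1 : I ≤ C * ENNReal.ofReal (S ^ (2 * s / N)) * gagliardoEnergy N s φ := by
    rw [gagliardoEnergy, ← lintegral_const_mul _ (measurable_gagliardoDensity N s hφ)]
    exact lintegral_mono fun x => hC φ hφ S hS hIS x
  have hpos : 0 < S ^ (2 * s / N) := Real.rpow_pos_of_pos hS _
  have h2 : I = ENNReal.ofReal (S ^ (2 * s / N)) * I ^ ((N - 2 * s) / N) := by
    rw [hIS, ENNReal.ofReal_rpow_of_pos hS, ← ENNReal.ofReal_mul hpos.le, ← Real.rpow_add hS]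
    congr 1
    have : 2 * s / (N : ℝ) + (N - 2 * s) / N = 1 := by field_simp; ring
    rw [this, Real.rpow_one]
  rw [mul_comm (C : ENNReal), mul_assoc] at h1
  nth_rewrite 1 [h2] at h1
  exact (ENNReal.mul_le_mul_iff_right (ENNReal.ofReal_pos.2 hpos).ne' ENNReal.ofReal_ne_top).1 h1

/-! ### The weighted Hardy-Sobolev inequality -/

theorem lintegral_hardy_ne_top {N : ℕ} [NeZero N] {s : ℝ} (hsN : 2 * s < N) {φ : RN N → ℝ}
    (hφ : Continuous φ) (hc : HasCompactSupport φ) :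
    ∫⁻ x, ENNReal.ofReal (φ x ^ 2 * ‖x‖ ^ (-(2 * s))) ≠ ⊤ := by
  have hN : 1 ≤ N := Nat.one_le_iff_ne_zero.2 (NeZero.ne N)
  have hdim : Module.finrank ℝ (RN N) = N := by simp
  obtain ⟨M, hM⟩ := hc.exists_bound_of_continuous hφ
  obtain ⟨R, hR0, hR⟩ := hc.isCompact.isBounded.subset_ball_lt 0 0
  have hint : IntegrableOn (fun x : RN N => M ^ 2 * ‖x‖ ^ (-(2 * s))) (Metric.ball 0 R) := by
    refine Integrable.const_mul ?_ _
    change IntegrableOn (fun x : RN N => ‖x‖ ^ (-(2 * s))) (Metric.ball 0 R)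
    rw [integrableOn_fun_norm_addHaar (μ := (volume : Measure (RN N)))
      (f := fun r : ℝ => r ^ (-(2 * s)))]
    have h1 : IntegrableOn (fun r : ℝ => r ^ ((N : ℝ) - 1 - 2 * s)) (Ioo 0 R) :=
      (intervalIntegral.integrableOn_Ioo_rpow_iff hR0).2 (by linarith)
    refine h1.congr_fun (fun r hr => ?_) measurableSet_Ioo
    simp only [smul_eq_mul]
    rw [hdim, ← Real.rpow_natCast, Nat.cast_sub hN, Nat.cast_one, ← Real.rpow_add hr.1]
    rfl
  have hle : ∫⁻ x, ENNReal.ofReal (φ x ^ 2 * ‖x‖ ^ (-(2 * s))) ≤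
      ∫⁻ x in Metric.ball (0 : RN N) R, ENNReal.ofReal (M ^ 2 * ‖x‖ ^ (-(2 * s))) := by
    rw [← lintegral_indicator measurableSet_ball]
    refine lintegral_mono fun x => ?_
    by_cases hx : x ∈ Metric.ball (0 : RN N) R
    · rw [indicator_of_mem hx]
      refine ENNReal.ofReal_le_ofReal (mul_le_mul_of_nonneg_right ?_ (by positivity))
      have := hM x
      rw [Real.norm_eq_abs] at this
      exact sq_le_sq.2 (this.trans (le_abs_self M))
    · rw [indicator_of_notMem hx, image_eq_zero_of_notMem_tsupport fun h => hx (hR h)]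
      simp
  exact ne_top_of_le_ne_top hint.lintegral_lt_top.ne hle

theorem lintegral_sobolev_ne_top {N : ℕ} {p : ℝ} (hp : 0 < p) {φ : RN N → ℝ}
    (hφ : Continuous φ) (hc : HasCompactSupport φ) :
    ∫⁻ x, ENNReal.ofReal (|φ x| ^ p) ≠ ⊤ := by
  have h1 : Continuous fun x => |φ x| ^ p := hφ.abs.rpow_const fun _ => Or.inr hp.le
  have h2 : HasCompactSupport fun x => |φ x| ^ p :=
    hc.comp_left (g := fun r => |r| ^ p) (by simp [hp.ne'])
  exact (h1.integrable_of_hasCompactSupport h2).lintegral_lt_top.ne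

/-- The **weighted fractional Hardy-Sobolev inequality**: Hölder's inequality with three factors
interpolates between the Hardy and the Sobolev inequality. -/
theorem weighted_hardy_sobolev (N : ℕ) [NeZero N] {s t : ℝ} (ht : 0 < t) (hts : t < 2 * s)
    (hsN : 2 * s < N) :
    ∃ C : NNReal, ∀ φ : RN N → ℝ, Continuous φ → HasCompactSupport φ →
      ∀ V : RN N → ENNReal, AEMeasurable V →
      ∫⁻ x, ENNReal.ofReal (φ x ^ 2) * V x ≤
        C * (∫⁻ x, (ENNReal.ofReal (‖x‖ ^ (2 * t / critExp N s t)) * V x) ^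
          ((N - t) / (2 * s - t))) ^ ((2 * s - t) / (N - t)) * gagliardoEnergy N s φ := by
  have hs : 0 < s := by linarith
  have hN0 : (0 : ℝ) < N := by linarith
  have hNs : (0 : ℝ) < N - 2 * s := by linarith
  have hNt : (0 : ℝ) < N - t := by linarith
  have hst : 0 < 2 * s - t := by linarith
  obtain ⟨C₁, hC₁⟩ := fractional_hardy N hs hsN
  obtain ⟨C₂, hC₂⟩ := fractional_sobolev N hs hsN
  set p : ℝ := 2 * N / (N - 2 * s) with hp
  have hp0 : 0 < p := by positivity
  set α : ℝ := 2 * t / critExp N s t with hα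
  set q : ℝ := (N - t) / (2 * s - t) with hq
  have hq0 : 0 < q := by positivity
  -- The Hölder exponents: `a` for the Hardy factor is forced by the power of `|x|`, `b` for the
  -- Sobolev factor by `a + b + 1/q = 1`. The powers of `φ` then add up to two. The Sobolev factor
  -- contributes the power `b'` of the energy.
  set a : ℝ := t * (N - 2 * s) / (2 * s * (N - t)) with ha
  have ha0 : 0 < a := by positivity
  set b : ℝ := (N - 2 * s) * (2 * s - t) / (2 * s * (N - t)) with hb
  have hb0 : 0 < b := by positivity
  have hqi : (2 * s - t) / (N - t) = q⁻¹ := by rw [hq, inv_div]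
  have hα' : α = 2 * s * a := by rw [hα, critExp, ha]; field_simp
  have hsum : a + b + q⁻¹ = 1 := by rw [ha, hb, ← hqi]; field_simp; ring
  have hphi : 2 * a + p * b = 2 := by rw [ha, hb, hp]; field_simp; ring
  set b' : ℝ := b / ((N - 2 * s) / N) with hb'
  have hab' : a + b' = 1 := by rw [ha, hb', hb]; field_simp; ring
  have hb'0 : 0 < b' := by positivity
  refine ⟨C₁ ^ a * C₂ ^ b', fun φ hφ hc V hV => ?_⟩
  set E := gagliardoEnergy N s φ
  have hm : Measurable φ := hφ.measurable
  have hH := hC₁ φ hm (lintegral_hardy_ne_top hsN hφ hc)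
  have hS := hC₂ φ hm (lintegral_sobolev_ne_top hp0 hφ hc)
  have hne : ∀ᵐ x : RN N, x ≠ 0 := Measure.ae_ne volume 0
  have hpt : ∀ᵐ x : RN N, ENNReal.ofReal (φ x ^ 2) * V x =
      ENNReal.ofReal (φ x ^ 2 * ‖x‖ ^ (-(2 * s))) ^ a * ENNReal.ofReal (|φ x| ^ p) ^ b *
        ((ENNReal.ofReal (‖x‖ ^ α) * V x) ^ q) ^ q⁻¹ := by
    filter_upwards [hne] with x hx
    have hx0 : 0 < ‖x‖ := norm_pos_iff.2 hx
    rcases eq_or_ne (φ x) 0 with h0 | h0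
    · simp [h0, ha0]
    have hφ0 : 0 < |φ x| := abs_pos.2 h0
    rw [ENNReal.rpow_rpow_inv hq0.ne', ← mul_assoc,
      ENNReal.ofReal_rpow_of_nonneg (by positivity) ha0.le,
      ENNReal.ofReal_rpow_of_nonneg (by positivity) hb0.le, ← ENNReal.ofReal_mul (by positivity),
      ← ENNReal.ofReal_mul (by positivity)]
    congr 2
    rw [← sq_abs, Real.mul_rpow (by positivity) (by positivity), ← Real.rpow_two,
      ← Real.rpow_mul hφ0.le, ← Real.rpow_mul hφ0.le, ← Real.rpow_mul hx0.le, hα']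
    have e1 : ‖x‖ ^ (-(2 * s) * a) * ‖x‖ ^ (2 * s * a) = 1 := by
      rw [← Real.rpow_add hx0]
      ring_nf
      rw [Real.rpow_zero]
    have e2 : |φ x| ^ (2 * a) * |φ x| ^ (p * b) = |φ x| ^ (2 : ℝ) := by
      rw [← Real.rpow_add hφ0, hphi]
    linear_combination -(e2 + |φ x| ^ (2 * a) * |φ x| ^ (p * b) * e1)
  have hhold := ENNReal.lintegral_prod_norm_pow_le (μ := (volume : Measure (RN N)))
    (Finset.univ : Finset (Fin 3))
    (f := ![fun x => ENNReal.ofReal (φ x ^ 2 * ‖x‖ ^ (-(2 * s))),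
      fun x => ENNReal.ofReal (|φ x| ^ p), fun x => (ENNReal.ofReal (‖x‖ ^ α) * V x) ^ q])
    (p := ![a, b, q⁻¹]) (by
      intro i _
      fin_cases i
      · exact (show Measurable fun x => ENNReal.ofReal (φ x ^ 2 * ‖x‖ ^ (-(2 * s))) by
          fun_prop).aemeasurable
      · exact (show Measurable fun x => ENNReal.ofReal (|φ x| ^ p) by fun_prop).aemeasurable
      · exact ((show Measurable fun x : RN N => ENNReal.ofReal (‖x‖ ^ α) by
          fun_prop).aemeasurable.mul hV).pow_const q)
    (by simpa [Fin.sum_univ_three] using hsum)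
    (by
      intro i _
      fin_cases i
      · exact ha0.le
      · exact hb0.le
      · exact (inv_pos.2 hq0).le)
  simp only [Fin.prod_univ_three, Matrix.cons_val_zero, Matrix.cons_val_one,
    Matrix.cons_val] at hhold
  rw [lintegral_congr_ae hpt, hqi]
  refine hhold.trans ?_
  have hSb : (∫⁻ x, ENNReal.ofReal (|φ x| ^ p)) ^ b ≤ (C₂ * E) ^ b' := by
    have : b = (N - 2 * s) / N * b' := by rw [hb']; field_simp
    rw [this, ENNReal.rpow_mul]
    gcongr
  calc _ ≤ (C₁ * E) ^ a * (C₂ * E) ^ b' *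
        (∫⁻ x, (ENNReal.ofReal (‖x‖ ^ α) * V x) ^ q) ^ q⁻¹ := by gcongr
    _ = _ := by
      rw [ENNReal.mul_rpow_of_nonneg _ _ ha0.le, ENNReal.mul_rpow_of_nonneg _ _ hb'0.le]
      have hE : E ^ a * E ^ b' = E := by
        rw [← ENNReal.rpow_add_of_nonneg _ _ ha0.le hb'0.le, hab', ENNReal.rpow_one]
      conv_rhs => rw [← hE]
      rw [ENNReal.coe_mul, ENNReal.coe_rpow_of_nonneg _ ha0.le,
        ENNReal.coe_rpow_of_nonneg _ hb'0.le]
      ring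

/-! ### Control of weighted norms by means over finitely many cubes -/

/-- The variance of a function, written as a double integral of its differences. -/
theorem measureReal_mul_integral_sq {α : Type*} [MeasurableSpace α] (μ : Measure α)
    [IsFiniteMeasure μ] {f : α → ℝ} (hf : MemLp f 2 μ) :
    μ.real univ * ∫ x, f x ^ 2 ∂μ =
      1 / 2 * ∫ p : α × α, (f p.1 - f p.2) ^ 2 ∂(μ.prod μ) + (∫ x, f x ∂μ) ^ 2 := by
  have h1 : Integrable f μ := hf.integrable one_le_two
  have h2 : Integrable (fun x => f x ^ 2) μ := hf.integrable_sq
  have hc : Integrable (fun _ : α => (1 : ℝ)) μ := integrable_const 1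
  have i1 : Integrable (fun p : α × α => f p.1 ^ 2 * 1) (μ.prod μ) := h2.mul_prod hc
  have i2 : Integrable (fun p : α × α => 1 * f p.2 ^ 2) (μ.prod μ) := hc.mul_prod h2
  have i3 : Integrable (fun p : α × α => f p.1 * f p.2) (μ.prod μ) := h1.mul_prod h1
  have e : ∀ p : α × α, (f p.1 - f p.2) ^ 2 =
      (f p.1 ^ 2 * 1 + 1 * f p.2 ^ 2) - 2 * (f p.1 * f p.2) := fun p => by ring
  simp_rw [e]
  have i12 : Integrable (fun p : α × α => f p.1 ^ 2 * 1 + 1 * f p.2 ^ 2) (μ.prod μ) := i1.add i2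
  rw [integral_sub i12 (i3.const_mul 2), integral_add i1 i2, integral_const_mul (2 : ℝ),
    integral_prod_mul (fun x => f x ^ 2) (fun _ => (1 : ℝ)),
    integral_prod_mul (fun _ => (1 : ℝ)) (fun x => f x ^ 2), integral_prod_mul f f]
  simp only [integral_const, smul_eq_mul, mul_one]
  ring

/-- A Poincaré inequality on a set of diameter at most `d`. -/
theorem volume_mul_setIntegral_sq_le {N : ℕ} {e : ℝ} (he : 0 ≤ e) {Q : Set (RN N)} {d : ℝ}
    (hQ : MeasurableSet Q) (hQf : volume Q ≠ ⊤) (hd : ∀ x ∈ Q, ∀ y ∈ Q, ‖x - y‖ ≤ d)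
    {φ : RN N → ℝ} (hφ : Continuous φ) (hc : HasCompactSupport φ)
    (hg : Integrable fun p : RN N × RN N => (φ p.1 - φ p.2) ^ 2 / ‖p.1 - p.2‖ ^ e) :
    volume.real Q * ∫ x in Q, φ x ^ 2 ≤
      1 / 2 * (d ^ e * ∫ p in Q ×ˢ Q, (φ p.1 - φ p.2) ^ 2 / ‖p.1 - p.2‖ ^ e) +
        (∫ x in Q, φ x) ^ 2 := by
  have : IsFiniteMeasure (volume.restrict Q) :=
    ⟨by rw [Measure.restrict_apply_univ]; exact hQf.lt_top⟩
  have hLp : MemLp φ 2 (volume.restrict Q) := (hφ.memLp_of_hasCompactSupport hc).restrict Q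
  have h1 := measureReal_mul_integral_sq (volume.restrict Q) hLp
  rw [measureReal_restrict_apply MeasurableSet.univ, univ_inter, Measure.prod_restrict] at h1
  rw [h1, ← integral_const_mul (d ^ e)]
  gcongr 1 / 2 * ?_ + _
  refine integral_mono_of_nonneg (Filter.Eventually.of_forall fun p => sq_nonneg _)
    ((hg.integrableOn (s := Q ×ˢ Q)).const_mul _) ?_
  filter_upwards [ae_restrict_mem (hQ.prod hQ)] with p hp
  have hd' := hd p.1 hp.1 p.2 hp.2
  have hd0 : 0 ≤ d := (norm_nonneg _).trans hd'
  rcases eq_or_ne p.1 p.2 with h | h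
  · simp [h]
  · have hpos : 0 < ‖p.1 - p.2‖ ^ e :=
      Real.rpow_pos_of_pos (norm_pos_iff.2 (sub_ne_zero.2 h)) _
    rw [← mul_div_assoc, le_div_iff₀ hpos, mul_comm]
    exact mul_le_mul_of_nonneg_right (Real.rpow_le_rpow (norm_nonneg _) hd' he) (sq_nonneg _)

/-- The half-open cube with side `δ` and index `j` in the grid `δ ℤ^N`. -/
def gridCube {N : ℕ} (δ : ℝ) (j : Fin N → ℤ) : Set (RN N) := {x | ∀ i, ⌊x i / δ⌋ = j i}

theorem gridCube_eq_preimage {N : ℕ} {δ : ℝ} (hδ : 0 < δ) (j : Fin N → ℤ) :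
    gridCube δ j = WithLp.ofLp ⁻¹'
      (univ.pi fun i => Ico (δ * (j i : ℝ)) (δ * ((j i : ℝ) + 1)) : Set (Fin N → ℝ)) := by
  ext x
  simp only [gridCube, mem_ofPred_eq, mem_preimage, mem_univ_pi, mem_Ico, Int.floor_eq_iff,
    le_div_iff₀' hδ, div_lt_iff₀' hδ]

theorem measurableSet_gridCube {N : ℕ} {δ : ℝ} (hδ : 0 < δ) (j : Fin N → ℤ) :
    MeasurableSet (gridCube δ j) := by
  rw [gridCube_eq_preimage hδ]
  exact (PiLp.volume_preserving_ofLp (Fin N)).measurable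
    (MeasurableSet.univ_pi fun _ => measurableSet_Ico)

theorem volume_gridCube {N : ℕ} {δ : ℝ} (hδ : 0 < δ) (j : Fin N → ℤ) :
    volume (gridCube δ j) = ENNReal.ofReal (δ ^ N) := by
  rw [gridCube_eq_preimage hδ, (PiLp.volume_preserving_ofLp (Fin N)).measure_preimage
    (MeasurableSet.univ_pi fun _ => measurableSet_Ico).nullMeasurableSet, Real.volume_pi_Ico]
  have : ∀ i, δ * ((j i : ℝ) + 1) - δ * j i = δ := fun i => by ring
  simp only [this, Finset.prod_const, Finset.card_univ, Fintype.card_fin, ENNReal.ofReal_pow hδ.le]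

theorem norm_sub_le_of_mem_gridCube {N : ℕ} {δ : ℝ} (hδ : 0 < δ) {j : Fin N → ℤ} {x y : RN N}
    (hx : x ∈ gridCube δ j) (hy : y ∈ gridCube δ j) : ‖x - y‖ ≤ √N * δ := by
  rw [EuclideanSpace.norm_eq]
  have h1 : ∀ i, ‖(x - y) i‖ ^ 2 ≤ δ ^ 2 := by
    intro i
    have hxi := Int.floor_eq_iff.1 (hx i)
    have hyi := Int.floor_eq_iff.1 (hy i)
    rw [le_div_iff₀ hδ, div_lt_iff₀ hδ] at hxi hyi
    refine pow_le_pow_left₀ (norm_nonneg _) ?_ 2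
    rw [PiLp.sub_apply, Real.norm_eq_abs, abs_le]
    constructor <;> linarith
  refine (Real.sqrt_le_sqrt (Finset.sum_le_sum fun i _ => h1 i)).trans ?_
  rw [Finset.sum_const, Finset.card_univ, Fintype.card_fin, nsmul_eq_mul,
    Real.sqrt_mul (Nat.cast_nonneg N), Real.sqrt_sq hδ.le]

theorem disjoint_gridCube {N : ℕ} {δ : ℝ} {j k : Fin N → ℤ} (h : j ≠ k) :
    Disjoint (gridCube δ j) (gridCube δ k) := by
  refine disjoint_left.2 fun x hx hy => h (funext fun i => ?_)
  rw [← hx i, ← hy i]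

theorem ball_subset_iUnion_gridCube {N : ℕ} {δ R : ℝ} (hδ : 0 < δ) :
    ∃ J : Finset (Fin N → ℤ), Metric.ball (0 : RN N) R ⊆ ⋃ j ∈ J, gridCube δ j := by
  refine ⟨Fintype.piFinset fun _ => Finset.Icc ⌊-R / δ⌋ ⌊R / δ⌋, fun x hx => ?_⟩
  rw [mem_iUnion₂]
  refine ⟨fun i => ⌊x i / δ⌋, Fintype.mem_piFinset.2 fun i => ?_, fun i => rfl⟩
  have h1 : |x i| ≤ R := by
    have h2 : ‖x i‖ ≤ ‖x‖ := PiLp.norm_apply_le x i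
    exact h2.trans (mem_ball_zero_iff.1 hx).le
  rw [abs_le] at h1
  exact Finset.mem_Icc.2 ⟨Int.floor_le_floor (div_le_div_of_nonneg_right h1.1 hδ.le),
    Int.floor_le_floor (div_le_div_of_nonneg_right h1.2 hδ.le)⟩

/-- Quantitative local compactness: up to a small multiple of the energy, the `L²` norm on a ball
is controlled by the means over finitely many cubes of a fine grid. -/
theorem setIntegral_ball_sq_le (N : ℕ) {s : ℝ} (hs : 0 < s) (R : ℝ) {ε : ℝ} (hε : 0 < ε) :
    ∃ (δ C : ℝ) (J : Finset (Fin N → ℤ)), 0 < δ ∧ 0 ≤ C ∧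
      ∀ φ : RN N → ℝ, Continuous φ → HasCompactSupport φ →
      Integrable (fun p : RN N × RN N =>
        (φ p.1 - φ p.2) ^ 2 / ‖p.1 - p.2‖ ^ ((N : ℝ) + 2 * s)) →
      ∫ x in Metric.ball 0 R, φ x ^ 2 ≤
        ε * (∫ p : RN N × RN N, (φ p.1 - φ p.2) ^ 2 / ‖p.1 - p.2‖ ^ ((N : ℝ) + 2 * s)) +
          C * ∑ j ∈ J, (∫ x in gridCube δ j, φ x) ^ 2 := by
  set e : ℝ := (N : ℝ) + 2 * s with he
  have he0 : 0 ≤ e := by positivity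
  -- The Poincaré constant of a cube of side `δ` is of order `δ^(2s)`.
  obtain ⟨δ, hδ0, hδ⟩ : ∃ δ : ℝ, 0 < δ ∧ 1 / 2 * (√N ^ e * δ ^ (2 * s)) ≤ ε := by
    have hlim : Filter.Tendsto (fun δ : ℝ => 1 / 2 * (√N ^ e * δ ^ (2 * s)))
        (nhdsWithin 0 (Ioi 0)) (nhds (1 / 2 * (√N ^ e * 0 ^ (2 * s)))) := by
      refine Filter.Tendsto.mono_left ?_ nhdsWithin_le_nhds
      exact ((Real.continuous_rpow_const (by positivity)).const_mul _ |>.const_mul _).tendsto 0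
    rw [Real.zero_rpow (by positivity), mul_zero, mul_zero] at hlim
    obtain ⟨δ, h1, h2⟩ := ((hlim.eventually (gt_mem_nhds hε)).and self_mem_nhdsWithin).exists
    exact ⟨δ, h2, h1.le⟩
  obtain ⟨J, hJ⟩ := ball_subset_iUnion_gridCube (N := N) (R := R) hδ0
  have hδN : 0 < δ ^ N := by positivity
  refine ⟨δ, (δ ^ N)⁻¹, J, hδ0, by positivity, fun φ hφ hc hg => ?_⟩
  set g : RN N × RN N → ℝ := fun p => (φ p.1 - φ p.2) ^ 2 / ‖p.1 - p.2‖ ^ e with hgdef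
  have hg0 : ∀ p, 0 ≤ g p := fun p => by positivity
  have hi : Integrable fun x => φ x ^ 2 :=
    (hφ.memLp_of_hasCompactSupport hc : MemLp φ 2 volume).integrable_sq
  have hcube : ∀ j, ∫ x in gridCube δ j, φ x ^ 2 ≤
      1 / 2 * (√N ^ e * δ ^ (2 * s)) * (∫ p in gridCube δ j ×ˢ gridCube δ j, g p) +
        (δ ^ N)⁻¹ * (∫ x in gridCube δ j, φ x) ^ 2 := by
    intro j
    have h1 := volume_mul_setIntegral_sq_le he0 (measurableSet_gridCube hδ0 j)
      (by rw [volume_gridCube hδ0]; exact ENNReal.ofReal_ne_top)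
      (fun x hx y hy => norm_sub_le_of_mem_gridCube hδ0 hx hy) hφ hc hg
    rw [Measure.real, volume_gridCube hδ0, ENNReal.toReal_ofReal hδN.le,
      Real.mul_rpow (Real.sqrt_nonneg _) hδ0.le, he, Real.rpow_add hδ0, Real.rpow_natCast,
      ← he] at h1
    refine le_of_mul_le_mul_left (h1.trans (le_of_eq ?_)) hδN
    field_simp
    rfl
  have hprod : ∑ j ∈ J, ∫ p in gridCube δ j ×ˢ gridCube δ j, g p ≤ ∫ p, g p := by
    rw [← integral_biUnion_finset J
      (fun j _ => (measurableSet_gridCube hδ0 j).prod (measurableSet_gridCube hδ0 j))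
      (fun j _ k _ hjk => Disjoint.set_prod_left (disjoint_gridCube hjk) _ _)
      (fun j _ => hg.integrableOn)]
    exact setIntegral_le_integral hg (Filter.Eventually.of_forall hg0)
  calc ∫ x in Metric.ball 0 R, φ x ^ 2
      ≤ ∫ x in ⋃ j ∈ J, gridCube δ j, φ x ^ 2 :=
        setIntegral_mono_set hi.integrableOn (Filter.Eventually.of_forall fun _ => sq_nonneg _)
          hJ.eventuallyLE
    _ = ∑ j ∈ J, ∫ x in gridCube δ j, φ x ^ 2 :=
        integral_biUnion_finset J (fun j _ => measurableSet_gridCube hδ0 j)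
          (fun j _ k _ hjk => disjoint_gridCube hjk) (fun j _ => hi.integrableOn)
    _ ≤ ∑ j ∈ J, (1 / 2 * (√N ^ e * δ ^ (2 * s)) *
          (∫ p in gridCube δ j ×ˢ gridCube δ j, g p) +
          (δ ^ N)⁻¹ * (∫ x in gridCube δ j, φ x) ^ 2) := Finset.sum_le_sum fun j _ => hcube j
    _ = 1 / 2 * (√N ^ e * δ ^ (2 * s)) *
          (∑ j ∈ J, ∫ p in gridCube δ j ×ˢ gridCube δ j, g p) +
          (δ ^ N)⁻¹ * ∑ j ∈ J, (∫ x in gridCube δ j, φ x) ^ 2 := by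
        rw [Finset.sum_add_distrib, Finset.mul_sum, Finset.mul_sum]
    _ ≤ _ := by
        gcongr

theorem lintegral_eq_gagliardoEnergy {N : ℕ} {s : ℝ} {φ : RN N → ℝ} (hφ : Measurable φ) :
    ∫⁻ p : RN N × RN N, ENNReal.ofReal
      ((φ p.1 - φ p.2) ^ 2 / ‖p.1 - p.2‖ ^ ((N : ℝ) + 2 * s)) = gagliardoEnergy N s φ :=
  lintegral_prod _ (by fun_prop)

theorem gagliardoEnergy_eq_ofReal {N : ℕ} {s : ℝ} {φ : RN N → ℝ} (hφ : Measurable φ)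
    (hg : Integrable (fun p : RN N × RN N =>
        (φ p.1 - φ p.2) ^ 2 / ‖p.1 - p.2‖ ^ ((N : ℝ) + 2 * s))) :
    gagliardoEnergy N s φ = ENNReal.ofReal (∫ p : RN N × RN N,
        (φ p.1 - φ p.2) ^ 2 / ‖p.1 - p.2‖ ^ ((N : ℝ) + 2 * s)) := by
  rw [← lintegral_eq_gagliardoEnergy hφ,
    ofReal_integral_eq_lintegral_ofReal hg (Filter.Eventually.of_forall fun p => by positivity)]

/-- Truncating an admissible weight to a ball and to bounded values leaves a remainder of small
weighted norm. -/
theorem exists_nat_setLIntegral_compl_le {N : ℕ} {V F : RN N → ENNReal} (hV : Measurable V)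
    (hVt : ∀ x, V x ≠ ⊤) (hfin : ∫⁻ x, F x ≠ ⊤) {η : ENNReal} (hη : 0 < η) :
    ∃ k : ℕ, ∫⁻ x in (Metric.ball 0 (k : ℝ) ∩ {x | V x ≤ k})ᶜ, F x < η := by
  set A : ℕ → Set (RN N) := fun k => (Metric.ball 0 (k : ℝ) ∩ {x | V x ≤ k})ᶜ with hA
  have hAm : ∀ k, MeasurableSet (A k) := fun k =>
    (measurableSet_ball.inter (measurableSet_le hV measurable_const)).compl
  have hfin' : volume.withDensity F univ ≠ ⊤ := by
    rwa [withDensity_apply _ MeasurableSet.univ, setLIntegral_univ]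
  have hanti : Antitone A := by
    intro j k hjk
    refine compl_subset_compl.2 (inter_subset_inter ?_ fun x hx => ?_)
    · exact Metric.ball_subset_ball (by exact_mod_cast hjk)
    · exact (show V x ≤ (j : ENNReal) from hx).trans (by exact_mod_cast hjk)
  have hlim := tendsto_measure_iInter_atTop (μ := volume.withDensity F)
    (fun k => (hAm k).nullMeasurableSet) hanti ⟨0, measure_ne_top_of_subset (subset_univ _) hfin'⟩
  have hempty : ⋂ k, A k = ∅ := by
    rw [hA, ← compl_iUnion, compl_empty_iff, eq_univ_iff_forall]
    intro x
    obtain ⟨m, hm⟩ := exists_nat_gt ‖x‖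
    obtain ⟨n, hn⟩ := ENNReal.exists_nat_gt (hVt x)
    refine mem_iUnion.2 ⟨max m n, mem_ball_zero_iff.2 (hm.trans_le ?_), hn.le.trans ?_⟩
    · exact_mod_cast le_max_left m n
    · exact_mod_cast le_max_right m n
  rw [hempty, measure_empty] at hlim
  obtain ⟨k, hk⟩ := (hlim.eventually (gt_mem_nhds hη)).exists
  refine ⟨k, ?_⟩
  rwa [Function.comp, withDensity_apply _ (hAm k)] at hk

/-- Quantitative compactness of the embedding: up to a small multiple of the energy, the weighted
`L²` norm is controlled by the means over finitely many cubes. -/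
theorem lintegral_sq_mul_weight_le (N : ℕ) [NeZero N] {s t : ℝ} (ht : 0 < t) (hts : t < 2 * s)
    (hsN : 2 * s < N) {V : RN N → ENNReal} (hV : Measurable V) (hVt : ∀ x, V x ≠ ⊤)
    (hfin : ∫⁻ x, (ENNReal.ofReal (‖x‖ ^ (2 * t / critExp N s t)) * V x) ^
          ((N - t) / (2 * s - t)) ≠ ⊤) {ε : ℝ} (hε : 0 < ε) :
    ∃ (δ C : ℝ) (J : Finset (Fin N → ℤ)), 0 < δ ∧ 0 ≤ C ∧
      ∀ φ : RN N → ℝ, Continuous φ → HasCompactSupport φ →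
      Integrable (fun p : RN N × RN N =>
        (φ p.1 - φ p.2) ^ 2 / ‖p.1 - p.2‖ ^ ((N : ℝ) + 2 * s)) →
      ∫⁻ x, ENNReal.ofReal (φ x ^ 2) * V x ≤
        ENNReal.ofReal ε * gagliardoEnergy N s φ +
          ENNReal.ofReal (C * ∑ j ∈ J, (∫ x in gridCube δ j, φ x) ^ 2) := by
  have hs : 0 < s := by linarith
  have hNt : (0 : ℝ) < N - t := by linarith
  have hst : 0 < 2 * s - t := by linarith
  obtain ⟨C₀, hC₀⟩ := weighted_hardy_sobolev N ht hts hsN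
  set q : ℝ := (N - t) / (2 * s - t) with hq
  have hq0 : 0 < q := by positivity
  have hqi : (2 * s - t) / (N - t) = q⁻¹ := by rw [hq, inv_div]
  have hqi0 : 0 < q⁻¹ := inv_pos.2 hq0
  set F : RN N → ENNReal :=
    fun x => (ENNReal.ofReal (‖x‖ ^ (2 * t / critExp N s t)) * V x) ^ q with hF
  have hFm : Measurable F := by
    refine Measurable.pow_const (Measurable.mul ?_ hV) q
    fun_prop
  obtain ⟨η, hη0, hη⟩ : ∃ η : ENNReal, 0 < η ∧
      ∀ z < η, (C₀ : ENNReal) * z ^ q⁻¹ ≤ ENNReal.ofReal (ε / 2) := by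
    have hlim : Filter.Tendsto (fun z : ENNReal => (C₀ : ENNReal) * z ^ q⁻¹) (nhds 0)
        (nhds (C₀ * 0 ^ q⁻¹)) :=
      ENNReal.Tendsto.const_mul (ENNReal.continuous_rpow_const.tendsto 0)
        (Or.inr ENNReal.coe_ne_top)
    rw [ENNReal.zero_rpow_of_pos hqi0, mul_zero] at hlim
    have h1 := hlim.eventually (gt_mem_nhds (ENNReal.ofReal_pos.2 (half_pos hε)))
    obtain ⟨η, hη0, hη⟩ := ENNReal.nhds_zero_basis.eventually_iff.1 h1
    exact ⟨η, hη0, fun z hz => (hη hz).le⟩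
  obtain ⟨k, hk⟩ := exists_nat_setLIntegral_compl_le hV hVt hfin hη0
  set A : Set (RN N) := Metric.ball 0 (k : ℝ) ∩ {x | V x ≤ k} with hA
  have hAm : MeasurableSet A := measurableSet_ball.inter (measurableSet_le hV measurable_const)
  have hk1 : (0 : ℝ) < k + 1 := by positivity
  obtain ⟨δ, C, J, hδ, hC, hball⟩ := setIntegral_ball_sq_le N hs (k : ℝ)
    (show 0 < ε / (2 * (k + 1)) by positivity)
  refine ⟨δ, (k + 1) * C, J, hδ, by positivity, fun φ hφ hc hg => ?_⟩
  have hm : Measurable φ := hφ.measurable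
  set E := gagliardoEnergy N s φ with hE
  have hcompl : ∫⁻ x in Aᶜ, ENNReal.ofReal (φ x ^ 2) * V x ≤ ENNReal.ofReal (ε / 2) * E := by
    have h1 := hC₀ φ hφ hc (Aᶜ.indicator V) (hV.indicator hAm.compl).aemeasurable
    have h2 : ∀ x, ENNReal.ofReal (φ x ^ 2) * Aᶜ.indicator V x =
        Aᶜ.indicator (fun x => ENNReal.ofReal (φ x ^ 2) * V x) x := by
      intro x
      by_cases hx : x ∈ Aᶜ
      · rw [indicator_of_mem hx, indicator_of_mem hx]
      · rw [indicator_of_notMem hx, indicator_of_notMem hx, mul_zero]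
    have h3 : ∀ x, (ENNReal.ofReal (‖x‖ ^ (2 * t / critExp N s t)) * Aᶜ.indicator V x) ^ q =
        Aᶜ.indicator F x := by
      intro x
      by_cases hx : x ∈ Aᶜ
      · rw [indicator_of_mem hx, indicator_of_mem hx]
      · rw [indicator_of_notMem hx, indicator_of_notMem hx, mul_zero,
          ENNReal.zero_rpow_of_pos hq0]
    simp_rw [h2, h3] at h1
    rw [lintegral_indicator hAm.compl, lintegral_indicator hAm.compl, hqi] at h1
    exact h1.trans (mul_le_mul_left (hη _ hk) _)
  have hin : ∫⁻ x in A, ENNReal.ofReal (φ x ^ 2) * V x ≤ ENNReal.ofReal (ε / 2) * E +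
      ENNReal.ofReal ((k + 1) * C * ∑ j ∈ J, (∫ x in gridCube δ j, φ x) ^ 2) := by
    have hi : Integrable fun x => φ x ^ 2 :=
      (hφ.memLp_of_hasCompactSupport hc : MemLp φ 2 volume).integrable_sq
    have hkk : ((k : ℕ) : ENNReal) ≤ ENNReal.ofReal (k + 1) := by
      rw [← ENNReal.ofReal_natCast]
      exact ENNReal.ofReal_le_ofReal (by linarith)
    calc ∫⁻ x in A, ENNReal.ofReal (φ x ^ 2) * V x
        ≤ ∫⁻ x in A, ENNReal.ofReal (k + 1) * ENNReal.ofReal (φ x ^ 2) := by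
          refine setLIntegral_mono' hAm fun x hx => ?_
          rw [mul_comm]
          exact mul_le_mul_left (le_trans hx.2 hkk) _
      _ ≤ ∫⁻ x in Metric.ball (0 : RN N) k, ENNReal.ofReal (k + 1) * ENNReal.ofReal (φ x ^ 2) :=
          lintegral_mono_set inter_subset_left
      _ = ENNReal.ofReal (k + 1) * ENNReal.ofReal (∫ x in Metric.ball (0 : RN N) k, φ x ^ 2) := by
          rw [lintegral_const_mul _ (by fun_prop), ofReal_integral_eq_lintegral_ofReal
            hi.integrableOn (Filter.Eventually.of_forall fun _ => sq_nonneg _)]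
      _ ≤ _ := by
          rw [gagliardoEnergy_eq_ofReal hm hg] at hE
          rw [hE, ← ENNReal.ofReal_mul hk1.le, ← ENNReal.ofReal_mul (by positivity),
            ← ENNReal.ofReal_add (by positivity)
              (mul_nonneg (by positivity) (Finset.sum_nonneg fun _ _ => sq_nonneg _))]
          refine ENNReal.ofReal_le_ofReal
            ((mul_le_mul_of_nonneg_left (hball φ hφ hc hg) hk1.le).trans (le_of_eq ?_))
          field_simp
  rw [← lintegral_add_compl _ hAm]
  calc _ ≤ (ENNReal.ofReal (ε / 2) * E +
        ENNReal.ofReal ((k + 1) * C * ∑ j ∈ J, (∫ x in gridCube δ j, φ x) ^ 2)) +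
          ENNReal.ofReal (ε / 2) * E := add_le_add hin hcompl
    _ = _ := by
      rw [add_right_comm, ← add_mul, ← ENNReal.ofReal_add (by positivity) (by positivity),
        add_halves]

/-! ### The embedding of the homogeneous fractional Sobolev space -/

theorem fracConst_pos (N : ℕ) [NeZero N] (s : Ioo (0 : ℝ) 1) : 0 < fracConst N s := by
  have hnn : ∀ ξ : RN N, 0 ≤ (1 - Real.cos (ξ 0)) / ‖ξ‖ ^ ((N : ℝ) + 2 * (s : ℝ)) := fun ξ =>
    div_nonneg (by linarith [Real.cos_le_one (ξ 0)]) (by positivity)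
  refine inv_pos.2 ((integral_pos_iff_support_of_nonneg hnn ?_).2 ?_)
  · refine ((integrable_gagliardoKernel N s.2).const_mul 2).mono' ?_
      (Filter.Eventually.of_forall fun ξ => ?_)
    · exact (by fun_prop : Measurable fun ξ : RN N =>
        (1 - Real.cos (ξ 0)) / ‖ξ‖ ^ ((N : ℝ) + 2 * (s : ℝ))).aestronglyMeasurable
    · rw [Real.norm_of_nonneg (hnn ξ), ← mul_div_assoc]
      refine div_le_div_of_nonneg_right ?_ (by positivity)
      have h1 : (ξ 0) ^ 2 ≤ ‖ξ‖ ^ 2 := sq_le_sq.2 (by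
        rw [abs_of_nonneg (norm_nonneg ξ)]
        exact PiLp.norm_apply_le ξ 0)
      have h2 := Real.one_sub_sq_div_two_le_cos (x := ξ 0)
      have h3 := Real.neg_one_le_cos (ξ 0)
      rcases min_cases (‖ξ‖ ^ 2) 1 with ⟨h, _⟩ | ⟨h, _⟩ <;> rw [h] <;> nlinarith
  · set U : Set (RN N) := {ξ | Real.cos (ξ 0) < 1} with hU
    have hUo : IsOpen U := isOpen_lt (by fun_prop) continuous_const
    have hUn : U.Nonempty := ⟨EuclideanSpace.single 0 Real.pi, by simp [hU]⟩
    refine (hUo.measure_pos volume hUn).trans_le (measure_mono fun ξ hξ => ?_)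
    have hξ1 : Real.cos (ξ 0) < 1 := hξ
    have hξ0 : ξ ≠ 0 := by
      rintro rfl
      simp at hξ1
    exact (div_pos (by linarith) (Real.rpow_pos_of_pos (norm_pos_iff.2 hξ0) _)).ne'

theorem TestFun.continuous {N : ℕ} {s : Ioo (0 : ℝ) 1} (φ : TestFun N s) : Continuous φ.1 :=
  (show ContDiff ℝ ∞ φ.1 from φ.2.1).continuous

theorem TestFun.hasCompactSupport {N : ℕ} {s : Ioo (0 : ℝ) 1} (φ : TestFun N s) :
    HasCompactSupport φ.1 := φ.2.2

theorem TestFun.gagliardoEnergy_eq {N : ℕ} [NeZero N] {s : Ioo (0 : ℝ) 1} (φ : TestFun N s) :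
    gagliardoEnergy N s φ = ENNReal.ofReal (2 / fracConst N s * ‖φ‖ ^ 2) := by
  rw [gagliardoEnergy_eq_ofReal φ.continuous.measurable (integrable_gagliardo_sq N s φ),
    ← real_inner_self_eq_norm_sq]
  congr 1
  change _ = 2 / fracConst N s * (fracConst N s / 2 * _)
  have := (fracConst_pos N s).ne'
  field_simp

/-- The square of the norm of `L²_w` as an integral against Lebesgue measure. -/
theorem eLpNorm_weightMeasure_rpow_two {N : ℕ} {w : RN N → ℝ} (hw : AEMeasurable w)
    {φ : RN N → ℝ} (hφ : Measurable φ) :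
    eLpNorm φ 2 (weightMeasure w) ^ (2 : ℝ) =
      ∫⁻ x, ENNReal.ofReal (φ x ^ 2) * ENNReal.ofReal (w x) := by
  have h1 := eLpNorm_nnreal_pow_eq_lintegral (f := φ) (μ := weightMeasure w) (p := 2) two_ne_zero
  have h2 : ∀ x, ‖φ x‖ₑ ^ (2 : ℝ) = ENNReal.ofReal (φ x ^ 2) := fun x => by
    rw [Real.enorm_eq_ofReal_abs, ENNReal.ofReal_rpow_of_nonneg (abs_nonneg _) zero_le_two,
      Real.rpow_two, sq_abs]
  rw [ENNReal.coe_ofNat, NNReal.coe_ofNat] at h1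
  rw [h1, weightMeasure, lintegral_withDensity_eq_lintegral_mul₀ hw.ennreal_ofReal (by fun_prop)]
  refine lintegral_congr fun x => ?_
  rw [Pi.mul_apply, h2, mul_comm]

theorem ofReal_norm_sq_eq {N : ℕ} {w : RN N → ℝ} (hw : AEMeasurable w) {φ : RN N → ℝ}
    (hφ : Measurable φ) {u : L2w w} (hu : u =ᵐ[weightMeasure w] φ) :
    ENNReal.ofReal (‖u‖ ^ 2) = ∫⁻ x, ENNReal.ofReal (φ x ^ 2) * ENNReal.ofReal (w x) := by
  rw [← eLpNorm_weightMeasure_rpow_two hw hφ, ← eLpNorm_congr_ae hu, Lp.norm_def,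
    ← ENNReal.toReal_pow, ENNReal.ofReal_toReal (ENNReal.pow_ne_top (Lp.eLpNorm_ne_top u)),
    ENNReal.rpow_two]

theorem lintegral_weight_rpow_ne_top {N : ℕ} {w : RN N → ℝ} {α q : ℝ} (hq : 0 < q)
    (hwL : MemLp (fun x : RN N => ‖x‖ ^ α * w x) (ENNReal.ofReal q)) :
    ∫⁻ x, (ENNReal.ofReal (‖x‖ ^ α) * ENNReal.ofReal (w x)) ^ q ≠ ⊤ := by
  have h1 := lintegral_rpow_enorm_lt_top_of_eLpNorm_lt_top
    (ENNReal.ofReal_pos.2 hq).ne' ENNReal.ofReal_ne_top hwL.eLpNorm_lt_top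
  rw [ENNReal.toReal_ofReal hq.le] at h1
  refine ne_top_of_le_ne_top h1.ne (lintegral_mono fun x => ?_)
  refine ENNReal.rpow_le_rpow ?_ hq.le
  rw [← ENNReal.ofReal_mul (by positivity), Real.enorm_eq_ofReal_abs]
  exact ENNReal.ofReal_le_ofReal (le_abs_self _)

/-- A bounded extension of the inclusion exists as soon as the weighted norm of a test function is
controlled by its Gagliardo norm. -/
theorem exists_extendsInclusion {N : ℕ} [NeZero N] {s : Ioo (0 : ℝ) 1} {w : RN N → ℝ}
    (hw : AEMeasurable w) {C : ℝ} (hC : 0 ≤ C)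
    (h : ∀ φ : TestFun N s, ∫⁻ x, ENNReal.ofReal (φ x ^ 2) * ENNReal.ofReal (w x) ≤
      ENNReal.ofReal (C * ‖φ‖ ^ 2)) :
    ∃ i : HDot N s →L[ℝ] L2w w, ExtendsInclusion i := by
  have hmem : ∀ φ : TestFun N s, MemLp φ.1 2 (weightMeasure w) := by
    intro φ
    refine ⟨φ.continuous.aestronglyMeasurable, ?_⟩
    have h1 : eLpNorm φ.1 2 (weightMeasure w) ^ (2 : ℝ) < ⊤ := by
      rw [eLpNorm_weightMeasure_rpow_two hw φ.continuous.measurable]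
      exact (h φ).trans_lt ENNReal.ofReal_lt_top
    exact (ENNReal.rpow_lt_top_iff_of_pos two_pos).1 h1
  let l : TestFun N s →ₗ[ℝ] L2w w :=
    { toFun := fun φ => (hmem φ).toLp
      map_add' := fun φ ψ => MemLp.toLp_add (hmem φ) (hmem ψ)
      map_smul' := fun c φ => MemLp.toLp_const_smul c (hmem φ) }
  have hl : ∀ φ : TestFun N s, ((l φ : L2w w) : RN N → ℝ) =ᵐ[weightMeasure w] φ.1 :=
    fun φ => (hmem φ).coeFn_toLp
  have hb : ∀ φ, ‖l φ‖ ≤ √C * ‖φ‖ := by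
    intro φ
    refine le_of_sq_le_sq ?_ (by positivity)
    rw [mul_pow, Real.sq_sqrt hC]
    refine (ENNReal.ofReal_le_ofReal_iff (by positivity)).1 ?_
    rw [ofReal_norm_sq_eq hw φ.continuous.measurable (hl φ)]
    exact h φ
  refine ⟨(l.mkContinuous _ hb).fromCompletion, fun φ => ?_⟩
  rw [ContinuousLinearMap.fromCompletion_apply_coe]
  exact hl φ

theorem ExtendsInclusion.unique {N : ℕ} [NeZero N] {s : Ioo (0 : ℝ) 1} {w : RN N → ℝ}
    {i j : HDot N s →L[ℝ] L2w w} (hi : ExtendsInclusion i) (hj : ExtendsInclusion j) : j = i := by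
  refine ContinuousLinearMap.ext fun u => ?_
  refine UniformSpace.Completion.induction_on u (isClosed_eq j.continuous i.continuous) fun φ => ?_
  exact Lp.ext ((hj φ).trans (hi φ).symm)

theorem volume_absolutelyContinuous_weightMeasure {N : ℕ} {w : RN N → ℝ} (hw : AEMeasurable w)
    (hwpos : ∀ᵐ x : RN N, 0 < w x) : volume ≪ weightMeasure w :=
  withDensity_absolutelyContinuous' hw.ennreal_ofReal
    (hwpos.mono fun _ hx => (ENNReal.ofReal_pos.2 hx).ne')

/-- Lower semicontinuity of the energy under pointwise convergence almost everywhere. -/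
theorem gagliardoEnergy_le_liminf {N : ℕ} {s : ℝ} {f : ℕ → RN N → ℝ} {g : RN N → ℝ}
    (hf : ∀ n, Measurable (f n)) (hg : Measurable g)
    (h : ∀ᵐ x, Filter.Tendsto (fun n => f n x) Filter.atTop (nhds (g x))) :
    gagliardoEnergy N s g ≤
      Filter.liminf (fun n => gagliardoEnergy N s (f n)) Filter.atTop := by
  simp_rw [← lintegral_eq_gagliardoEnergy (hf _), ← lintegral_eq_gagliardoEnergy hg]
  refine le_trans (le_of_eq (lintegral_congr_ae ?_)) (lintegral_liminf_le fun n => ?_)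
  · have h1 := (Measure.quasiMeasurePreserving_fst (μ := (volume : Measure (RN N)))
      (ν := (volume : Measure (RN N)))).ae h
    have h2 := (Measure.quasiMeasurePreserving_snd (μ := (volume : Measure (RN N)))
      (ν := (volume : Measure (RN N)))).ae h
    filter_upwards [h1, h2] with p hp1 hp2
    exact (ENNReal.tendsto_ofReal (((hp1.sub hp2).pow 2).div_const _)).liminf_eq.symm
  · have := hf n
    fun_prop

/-- The extension of the inclusion to the completion stays injective: if `φ n` is Cauchy for the
Gagliardo norm and tends to zero in `L²_w`, then, by Fatou's lemma along a subsequence, it tends to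
zero for the Gagliardo norm. -/
theorem ExtendsInclusion.injective {N : ℕ} [NeZero N] {s : Ioo (0 : ℝ) 1} {w : RN N → ℝ}
    (hw : AEMeasurable w) (hwpos : ∀ᵐ x : RN N, 0 < w x)
    {i : HDot N s →L[ℝ] L2w w} (hi : ExtendsInclusion i) : Function.Injective i := by
  refine (injective_iff_map_eq_zero i).2 fun u hu => ?_
  obtain ⟨φ, hφ⟩ : ∃ φ : ℕ → TestFun N s,
      Filter.Tendsto (fun n => (φ n : HDot N s)) Filter.atTop (nhds u) := by
    obtain ⟨x, hx, hxu⟩ := mem_closure_iff_seq_limit.1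
      (UniformSpace.Completion.denseRange_coe (α := TestFun N s) u)
    choose φ hφ using hx
    exact ⟨φ, by simpa only [hφ] using hxu⟩
  have hi0 : Filter.Tendsto (fun n => i (φ n)) Filter.atTop (nhds 0) := by
    have := (i.continuous.tendsto u).comp hφ
    rwa [hu] at this
  obtain ⟨ns, hns, hae⟩ := (tendstoInMeasure_of_tendsto_Lp hi0).exists_seq_tendsto_ae
  have hae' : ∀ᵐ x, Filter.Tendsto (fun n => (φ (ns n)) x) Filter.atTop (nhds 0) := by
    refine volume_absolutelyContinuous_weightMeasure hw hwpos ?_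
    filter_upwards [hae, Lp.coeFn_zero ℝ 2 (weightMeasure w), ae_all_iff.2 fun n => hi (φ n)]
      with x h1 h2 h3
    simpa only [h2, h3, Pi.zero_apply] using h1
  have hψ : Filter.Tendsto (fun n => (φ (ns n) : HDot N s)) Filter.atTop (nhds u) :=
    hφ.comp hns.tendsto_atTop
  have hc := fracConst_pos N s
  have key : ∀ ε : ℝ, 0 < ε → ‖u‖ ≤ ε := by
    intro ε hε
    obtain ⟨n₀, hn₀⟩ := Metric.cauchySeq_iff.1 hψ.cauchySeq ε hε
    refine le_of_tendsto hψ.norm (Filter.eventually_atTop.2 ⟨n₀, fun n hn => ?_⟩)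
    have h1 := gagliardoEnergy_le_liminf (s := s) (g := (φ (ns n)).1)
      (f := fun m => (φ (ns n) - φ (ns m)).1) (fun m => TestFun.continuous _ |>.measurable)
      (TestFun.continuous _).measurable (by
        filter_upwards [hae'] with x hx
        have := (tendsto_const_nhds (x := (φ (ns n)).1 x)).sub hx
        rwa [sub_zero] at this)
    have h2 : Filter.liminf (fun m => gagliardoEnergy N s (φ (ns n) - φ (ns m)).1) Filter.atTop ≤
        ENNReal.ofReal (2 / fracConst N s * ε ^ 2) := by
      refine Filter.liminf_le_of_frequently_le' (Filter.Eventually.frequently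
        (Filter.eventually_atTop.2 ⟨n₀, fun m hm => ?_⟩))
      rw [TestFun.gagliardoEnergy_eq]
      have h3 := hn₀ n hn m hm
      rw [dist_eq_norm, ← UniformSpace.Completion.coe_sub, UniformSpace.Completion.norm_coe] at h3
      gcongr
    have h4 := h1.trans h2
    rw [TestFun.gagliardoEnergy_eq, ENNReal.ofReal_le_ofReal_iff (by positivity)] at h4
    rw [UniformSpace.Completion.norm_coe]
    exact le_of_sq_le_sq (le_of_mul_le_mul_left h4 (by positivity)) hε.le
  exact norm_le_zero_iff.1 (le_of_forall_pos_le_add fun ε hε => by simpa using key ε hε)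

/-- The integral over a set of finite measure is a continuous functional on `Ḣ^s`, by the Sobolev
inequality. -/
theorem exists_setIntegral_functional {N : ℕ} [NeZero N] {s : Ioo (0 : ℝ) 1}
    (hsN : 2 * (s : ℝ) < N) {Q : Set (RN N)} (hQ : volume Q ≠ ⊤) :
    ∃ ℓ : HDot N s →L[ℝ] ℝ, ∀ φ : TestFun N s, ℓ φ = ∫ x in Q, φ x := by
  have hs := s.2.1
  have hN0 : (0 : ℝ) < N := by linarith
  have hNs : (0 : ℝ) < N - 2 * s := by linarith
  have hc := fracConst_pos N s
  obtain ⟨C, hC⟩ := fractional_sobolev N hs hsN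
  set p : ℝ := 2 * N / (N - 2 * s) with hp
  have hp0 : 0 < p := by positivity
  have hp1 : 1 ≤ p := by rw [hp, le_div_iff₀ hNs]; linarith
  have hpi : (N - 2 * (s : ℝ)) / N = p⁻¹ * 2 := by rw [hp]; field_simp
  have hint : ∀ φ : TestFun N s, Integrable φ.1 := fun φ =>
    φ.continuous.integrable_of_hasCompactSupport φ.hasCompactSupport
  let l : TestFun N s →ₗ[ℝ] ℝ :=
    { toFun := fun φ => ∫ x in Q, φ x
      map_add' := fun φ ψ => integral_add (hint φ).integrableOn (hint ψ).integrableOn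
      map_smul' := fun c φ => integral_const_mul c _ }
  set K : ℝ := √(C * (2 / fracConst N s)) * (volume Q ^ (1 - p⁻¹)).toReal with hK
  have hV : volume Q ^ (1 - p⁻¹) ≠ ⊤ :=
    ENNReal.rpow_ne_top_of_nonneg (sub_nonneg.2 (inv_le_one_of_one_le₀ hp1)) hQ
  have hb : ∀ φ, ‖l φ‖ ≤ K * ‖φ‖ := by
    intro φ
    have hm := φ.continuous.measurable
    set I := ∫⁻ x, ENNReal.ofReal (|φ x| ^ p) with hI
    have h1 : I ^ p⁻¹ ≤ ENNReal.ofReal (√(C * (2 / fracConst N s)) * ‖φ‖) := by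
      have h2 := hC φ.1 hm (lintegral_sobolev_ne_top hp0 φ.continuous φ.hasCompactSupport)
      rw [hpi, ENNReal.rpow_mul, φ.gagliardoEnergy_eq, ← ENNReal.ofReal_coe_nnreal,
        ← ENNReal.ofReal_mul (NNReal.coe_nonneg C), ← mul_assoc] at h2
      refine (ENNReal.rpow_le_rpow_iff two_pos).1 (h2.trans (le_of_eq ?_))
      rw [ENNReal.ofReal_rpow_of_nonneg (by positivity) zero_le_two, Real.rpow_two, mul_pow,
        Real.sq_sqrt (by positivity)]
    have h3 : ∫⁻ x in Q, ENNReal.ofReal |φ x| ≤ I ^ p⁻¹ * volume Q ^ (1 - p⁻¹) := by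
      have h4 := ENNReal.lintegral_mul_norm_pow_le (μ := volume.restrict Q)
        (f := fun y => ENNReal.ofReal (|φ y| ^ p)) (g := fun _ => 1) (by fun_prop) (by fun_prop)
        (p := p⁻¹) (q := 1 - p⁻¹) (by positivity)
        (sub_nonneg.2 (inv_le_one_of_one_le₀ hp1)) (by ring)
      simp only [ENNReal.one_rpow, mul_one, lintegral_one, Measure.restrict_apply_univ] at h4
      have h5 : ∀ y, ENNReal.ofReal (|φ y| ^ p) ^ p⁻¹ = ENNReal.ofReal |φ y| := fun y => by
        rw [ENNReal.ofReal_rpow_of_nonneg (by positivity) (by positivity),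
          Real.rpow_rpow_inv (abs_nonneg _) hp0.ne']
      simp_rw [h5] at h4
      refine h4.trans ?_
      gcongr
      exact setLIntegral_le_lintegral _ _
    have h6 : ENNReal.ofReal ‖l φ‖ ≤ ENNReal.ofReal (K * ‖φ‖) := by
      calc ENNReal.ofReal ‖l φ‖ ≤ ∫⁻ x in Q, ENNReal.ofReal |φ x| := by
            rw [ofReal_norm]
            refine (enorm_integral_le_lintegral_enorm _).trans (le_of_eq ?_)
            exact lintegral_congr fun x => Real.enorm_eq_ofReal_abs _
        _ ≤ I ^ p⁻¹ * volume Q ^ (1 - p⁻¹) := h3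
        _ ≤ ENNReal.ofReal (√(C * (2 / fracConst N s)) * ‖φ‖) * volume Q ^ (1 - p⁻¹) := by gcongr
        _ = _ := by
            rw [← ENNReal.ofReal_toReal hV, ← ENNReal.ofReal_mul (by positivity), hK]
            congr 1
            ring
    exact (ENNReal.ofReal_le_ofReal_iff (by positivity)).1 h6
  refine ⟨(l.mkContinuous _ hb).fromCompletion, fun φ => ?_⟩
  rw [ContinuousLinearMap.fromCompletion_apply_coe]
  rfl

/-! ### Compactness and the solution operator -/

/-- Compactness of the embedding: on the closed subspace of finite codimension on which the means
over finitely many cubes vanish, the operator has small norm. -/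
theorem ExtendsInclusion.isCompactOperator {N : ℕ} [NeZero N] {s : Ioo (0 : ℝ) 1} {t : ℝ}
    (ht : 0 < t) (hts : t < 2 * (s : ℝ)) (hsN : 2 * (s : ℝ) < N)
    {w : RN N → ℝ} (hw : AEMeasurable w)
    (hwL : MemLp (fun x : RN N => ‖x‖ ^ (2 * t / critExp N s t) * w x)
      (ENNReal.ofReal ((N - t) / (2 * s - t))))
    {i : HDot N s →L[ℝ] L2w w} (hi : ExtendsInclusion i) : IsCompactOperator i := by
  have hq : 0 < ((N : ℝ) - t) / (2 * s - t) := div_pos (by linarith) (by linarith)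
  have hc := fracConst_pos N s
  -- A Borel representative of the weight, so that its sublevel sets are measurable.
  set V : RN N → ENNReal := fun x => ENNReal.ofReal (hw.mk w x) with hV
  have hVm : Measurable V := hw.measurable_mk.ennreal_ofReal
  have hVw : ∀ᵐ x, ENNReal.ofReal (w x) = V x := hw.ae_eq_mk.mono fun x hx => by rw [hV, hx]
  have hfin : ∫⁻ x, (ENNReal.ofReal (‖x‖ ^ (2 * t / critExp N s t)) * V x) ^
      (((N : ℝ) - t) / (2 * s - t)) ≠ ⊤ := by
    have h1 := lintegral_weight_rpow_ne_top hq hwL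
    refine ne_of_eq_of_ne (lintegral_congr_ae (hVw.mono fun x hx => ?_)) h1
    simp only [hx]
  refine isCompactOperator_of_small_on_ker fun ε hε => ?_
  obtain ⟨δ, C, J, hδ, hC, hmain⟩ := lintegral_sq_mul_weight_le N ht hts hsN hVm
    (fun x => ENNReal.ofReal_ne_top) hfin (show 0 < ε ^ 2 * (fracConst N s / 2) by positivity)
  have hex : ∀ j : Fin N → ℤ, ∃ ℓ : HDot N s →L[ℝ] ℝ,
      ∀ φ : TestFun N s, ℓ φ = ∫ x in gridCube δ j, φ x := fun j =>
    exists_setIntegral_functional hsN (by rw [volume_gridCube hδ]; exact ENNReal.ofReal_ne_top)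
  choose ℓ hℓ using hex
  have hbound : ∀ u : HDot N s, ‖i u‖ ^ 2 ≤ ε ^ 2 * ‖u‖ ^ 2 + C * ∑ j ∈ J, ℓ j u ^ 2 := by
    intro u
    refine UniformSpace.Completion.induction_on u
      (isClosed_le (by fun_prop) (by fun_prop)) fun φ => ?_
    have hS : 0 ≤ C * ∑ j ∈ J, ℓ j φ ^ 2 :=
      mul_nonneg hC (Finset.sum_nonneg fun _ _ => sq_nonneg _)
    refine (ENNReal.ofReal_le_ofReal_iff (by positivity)).1 ?_
    have hV2 : ∫⁻ x, ENNReal.ofReal (φ x ^ 2) * ENNReal.ofReal (w x) =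
        ∫⁻ x, ENNReal.ofReal (φ x ^ 2) * V x :=
      lintegral_congr_ae (hVw.mono fun x hx => by simp only [hx])
    rw [ofReal_norm_sq_eq hw φ.continuous.measurable (hi φ), hV2]
    refine (hmain φ.1 φ.continuous φ.hasCompactSupport (integrable_gagliardo_sq N s φ)).trans ?_
    rw [φ.gagliardoEnergy_eq, ← ENNReal.ofReal_mul (by positivity),
      UniformSpace.Completion.norm_coe,
      ENNReal.ofReal_add (by positivity) hS]
    simp_rw [hℓ]
    refine add_le_add_left (ENNReal.ofReal_le_ofReal (le_of_eq ?_)) _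
    field_simp
  refine ⟨J.card, ContinuousLinearMap.pi fun k => ℓ (J.equivFin.symm k), fun u hu => ?_⟩
  have h0 : ∀ j ∈ J, ℓ j u = 0 := by
    intro j hj
    have := congrFun hu (J.equivFin ⟨j, hj⟩)
    simpa using this
  have h1 := hbound u
  rw [Finset.sum_eq_zero fun j hj => by rw [h0 j hj]; norm_num, mul_zero, add_zero,
    ← mul_pow] at h1
  exact le_of_sq_le_sq h1 (by positivity)

theorem integral_weightMeasure {N : ℕ} {w : RN N → ℝ} (hw : AEMeasurable w)
    (hwpos : ∀ᵐ x : RN N, 0 < w x) (g : RN N → ℝ) :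
    ∫ x, g x ∂weightMeasure w = ∫ x, g x * w x := by
  rw [weightMeasure, integral_withDensity_eq_integral_toReal_smul₀ hw.ennreal_ofReal
    (Filter.Eventually.of_forall fun x => ENNReal.ofReal_lt_top)]
  refine integral_congr_ae (hwpos.mono fun x hx => ?_)
  simp only [ENNReal.toReal_ofReal hx.le, smul_eq_mul, mul_comm]

theorem integrable_mul_weight {N : ℕ} {w : RN N → ℝ} (hw : AEMeasurable w)
    (hwpos : ∀ᵐ x : RN N, 0 < w x) {g : RN N → ℝ} (hg : Integrable g (weightMeasure w)) :
    Integrable fun x => g x * w x := by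
  rw [weightMeasure, integrable_withDensity_iff_integrable_smul₀' hw.ennreal_ofReal
    (Filter.Eventually.of_forall fun x => ENNReal.ofReal_lt_top)] at hg
  refine hg.congr (hwpos.mono fun x hx => ?_)
  simp only [ENNReal.toReal_ofReal hx.le, smul_eq_mul, mul_comm]

theorem inner_L2w_eq {N : ℕ} {w : RN N → ℝ} (hw : AEMeasurable w)
    (hwpos : ∀ᵐ x : RN N, 0 < w x) {φ : RN N → ℝ} (f : L2w w) {u : L2w w}
    (hu : u =ᵐ[weightMeasure w] φ) : ⟪f, u⟫ = ∫ x, f x * φ x * w x := by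
  rw [L2.inner_def, ← integral_weightMeasure hw hwpos fun x => f x * φ x]
  refine integral_congr_ae (hu.mono fun x hx => ?_)
  simp only [hx, RCLike.inner_apply, conj_trivial, mul_comm]

/-- A weight is locally integrable as soon as the test functions belong to `L²_w`: compare with a
smooth function that equals one on a given compact set. -/
theorem locallyIntegrable_of_lintegral_sq_mul_lt_top {N : ℕ} {w : RN N → ℝ} (hw : AEMeasurable w)
    (hwpos : ∀ᵐ x : RN N, 0 < w x)
    (h : ∀ φ : RN N → ℝ, ContDiff ℝ ∞ φ → HasCompactSupport φ →
      ∫⁻ x, ENNReal.ofReal (φ x ^ 2) * ENNReal.ofReal (w x) < ⊤) : LocallyIntegrable w := by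
  rw [locallyIntegrable_iff]
  intro K hK
  obtain ⟨R, hR0, hR⟩ := hK.isBounded.subset_closedBall_lt 0 0
  let b : ContDiffBump (0 : RN N) := ⟨R, R + 1, hR0, by linarith⟩
  refine ⟨hw.aestronglyMeasurable.restrict, lt_of_le_of_lt ?_ (h b b.contDiff b.hasCompactSupport)⟩
  refine le_trans ?_ (setLIntegral_le_lintegral K _)
  refine lintegral_mono_ae ?_
  filter_upwards [ae_restrict_of_ae hwpos, ae_restrict_mem hK.measurableSet] with x hx hxK
  rw [b.one_of_mem_closedBall (hR hxK), one_pow, ENNReal.ofReal_one, one_mul,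
    Real.enorm_eq_ofReal hx.le]

/-- The test functions are total in `L²_w`: a function of `L²_w` that is orthogonal to all of them
vanishes. -/
theorem eq_zero_of_forall_integral_mul_weight_eq_zero {N : ℕ} {w : RN N → ℝ} (hw : AEMeasurable w)
    (hwpos : ∀ᵐ x : RN N, 0 < w x) (hloc : LocallyIntegrable w) {f : L2w w}
    (h : ∀ φ : RN N → ℝ, ContDiff ℝ ∞ φ → HasCompactSupport φ → ∫ x, f x * φ x * w x = 0) :
    f = 0 := by
  have hac := volume_absolutelyContinuous_weightMeasure hw hwpos
  have hfm : AEStronglyMeasurable (f : RN N → ℝ) volume := (Lp.aestronglyMeasurable f).mono_ac hac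
  have hf2 : Integrable (fun x => f x ^ 2 * w x) :=
    integrable_mul_weight hw hwpos (Lp.memLp f).integrable_sq
  have hfw : LocallyIntegrable fun x => f x * w x := by
    refine (hf2.locallyIntegrable.add hloc).mono (hfm.mul hw.aestronglyMeasurable) ?_
    filter_upwards [hwpos] with x hx
    have h1 : |f x| ≤ f x ^ 2 + 1 := by
      rw [← sq_abs]
      nlinarith [sq_nonneg (|f x| - 1), abs_nonneg (f x)]
    rw [norm_mul, Real.norm_of_nonneg hx.le, Pi.add_apply, ← add_one_mul,
      Real.norm_of_nonneg (mul_nonneg (by positivity) hx.le)]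
    exact mul_le_mul_of_nonneg_right h1 hx.le
  have h0 : ∀ᵐ x : RN N, f x * w x = 0 := by
    refine ae_eq_zero_of_integral_contDiff_smul_eq_zero hfw fun φ hφ hc => ?_
    rw [← h φ hφ hc]
    refine integral_congr_ae (Filter.Eventually.of_forall fun x => ?_)
    simp only [smul_eq_mul]
    ring
  have h1 : ∀ᵐ x : RN N, f x = 0 := by
    filter_upwards [h0, hwpos] with x hx hx'
    exact (mul_eq_zero.1 hx).resolve_right hx'.ne'
  refine Lp.ext ?_
  have h2 : ∀ᵐ x ∂weightMeasure w, f x = 0 := (withDensity_absolutelyContinuous _ _) h1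
  filter_upwards [h2, Lp.coeFn_zero ℝ 2 (weightMeasure w)] with x hx hx'
  rw [hx, hx', Pi.zero_apply]

theorem theoremA2 (N : ℕ) [NeZero N] (s : Ioo (0 : ℝ) 1) (t : ℝ)
    (ht : 0 < t) (hts : t < 2 * (s : ℝ)) (hsN : 2 * (s : ℝ) < N)
    (w : RN N → ℝ) (hw : AEMeasurable w) (hwpos : ∀ᵐ x : RN N, 0 < w x)
    (hwL : MemLp (fun x : RN N => ‖x‖ ^ (2 * t / critExp N s t) * w x)
      (ENNReal.ofReal ((N - t) / (2 * s - t)))) :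
    ∃ (i : HDot N s →L[ℝ] L2w w) (T : L2w w →L[ℝ] HDot N s),
      -- `i` is the embedding: it is the only bounded operator that extends the inclusion of
      -- `C_c^∞`, and it is injective
      ExtendsInclusion i ∧
      (∀ j : HDot N s →L[ℝ] L2w w, ExtendsInclusion j → j = i) ∧
      Function.Injective i ∧
      -- the embedding is compact
      IsCompactOperator i ∧
      -- `T` is the inverse of the operator `(-Δ)^s / w`, which is single-valued and is onto `L²_w`
      (∀ (f : L2w w) (v : HDot N s), IsWeakSolution v f ↔ v = T f) ∧
      Function.Injective T ∧
      -- `i ∘ T` is compact and self-adjoint, with discrete spectrum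
      IsCompactOperator (i ∘L T) ∧
      IsSelfAdjoint (i ∘L T) ∧
      HasDiscreteSpectrum (i ∘L T) := by
  have hc := fracConst_pos N s
  have hq : 0 < ((N : ℝ) - t) / (2 * s - t) := div_pos (by linarith) (by linarith)
  have hqi : 0 ≤ (2 * (s : ℝ) - t) / ((N : ℝ) - t) := div_nonneg (by linarith) (by linarith)
  obtain ⟨C₀, hC₀⟩ := weighted_hardy_sobolev N ht hts hsN
  have hWt := ENNReal.rpow_ne_top_of_nonneg hqi (lintegral_weight_rpow_ne_top hq hwL)
  set W := (∫⁻ x, (ENNReal.ofReal (‖x‖ ^ (2 * t / critExp N s t)) * ENNReal.ofReal (w x)) ^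
      (((N : ℝ) - t) / (2 * s - t))) ^ ((2 * (s : ℝ) - t) / ((N : ℝ) - t)) with hW
  have hemb : ∀ φ : TestFun N s, ∫⁻ x, ENNReal.ofReal (φ x ^ 2) * ENNReal.ofReal (w x) ≤
      ENNReal.ofReal ((C₀ * W.toReal * (2 / fracConst N s)) * ‖φ‖ ^ 2) := by
    intro φ
    refine (hC₀ φ.1 φ.continuous φ.hasCompactSupport _ hw.ennreal_ofReal).trans (le_of_eq ?_)
    rw [φ.gagliardoEnergy_eq, ← hW, ← ENNReal.ofReal_toReal hWt, ← ENNReal.ofReal_coe_nnreal,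
      ← ENNReal.ofReal_mul (by positivity), ← ENNReal.ofReal_mul (by positivity),
      ENNReal.toReal_ofReal ENNReal.toReal_nonneg, mul_assoc, mul_assoc, mul_assoc]
  obtain ⟨i, hi⟩ := exists_extendsInclusion hw (by positivity) hemb
  have hic : IsCompactOperator i := hi.isCompactOperator ht hts hsN hw hwL
  have hloc : LocallyIntegrable w := locallyIntegrable_of_lintegral_sq_mul_lt_top hw hwpos
    fun φ hφ hc => (hemb (⟨φ, hφ, hc⟩ : smoothCompactSupport N)).trans_lt ENNReal.ofReal_lt_top
  -- The weak equation says precisely that `v` is the value of the adjoint of `i` at `f`.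
  set T : L2w w →L[ℝ] HDot N s := ContinuousLinearMap.adjoint i with hT
  have hTφ : ∀ (f : L2w w) (φ : TestFun N s), ⟪T f, (φ : HDot N s)⟫ = ∫ x, f x * φ x * w x :=
    fun f φ => by rw [hT, ContinuousLinearMap.adjoint_inner_left, inner_L2w_eq hw hwpos f (hi φ)]
  have hcomp : IsCompactOperator (i ∘L T) := hic.comp_clm T
  have hsa : IsSelfAdjoint (i ∘L T) := by
    rw [ContinuousLinearMap.isSelfAdjoint_iff', ContinuousLinearMap.adjoint_comp, hT,
      ContinuousLinearMap.adjoint_adjoint]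
  refine ⟨i, T, hi, fun j hj => hi.unique hj, hi.injective hw hwpos, hic,
    fun f v => ⟨fun h => ?_, ?_⟩,
    (injective_iff_map_eq_zero T).2 fun f hf => ?_, hcomp, hsa,
    hasDiscreteSpectrum_of_isCompactOperator hcomp hsa⟩
  · refine ext_inner_right ℝ fun u => ?_
    refine UniformSpace.Completion.induction_on u
      (isClosed_eq (by fun_prop) (by fun_prop)) fun φ => ?_
    rw [h φ, hTφ]
  · rintro rfl φ
    exact hTφ f φ
  · refine eq_zero_of_forall_integral_mul_weight_eq_zero hw hwpos hloc fun φ hφ hc => ?_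
    have h1 := hTφ f (⟨φ, hφ, hc⟩ : smoothCompactSupport N)
    rw [hf, inner_zero_left] at h1
    exact h1.symm
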